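/- Let $\Gamma$ be a simplicial graph with finite vertex set $S$, and let $W_\Gamma=\langle S \mid s^2=1\ (s\in S),\ st=ts \text{ for adjacent } s,t\rangle$ be the associated right-angled Coxeter group. A word in $S$ is reduced if no shorter word represents the same element of $W_\Gamma$. A subgroup $G\le W_\Gamma$ is *quasiconvex* if there is $M\ge 0$ such that every geodesic with endpoints in $G$ in the Cayley graph of $W_\Gamma$ with respect to $S$ lies in the $M$-neighbourhood of $G$. A *$\Gamma$-labeled cube complex* is a cube complex whose edges are labeled by vertices of $\Gamma$, such that parallel edges of a cube have the same label and the edges of a cube at one of its corners have distinct, pairwise adjacent labels. (Cubes need not be embedded; an edge may be a graph-loop.) There are three operations on such complexes: a *fold* identifies two distinct edges with the same label and a common endpoint $v$, oriented away from $v$ (with an arbitrary orientation for a graph-loop); a *cube identification* identifies the cubes of a collection of two or more distinct $i$-cubes, $i\ge2$, with equal boundaries (that is, with the same attaching map up to a label-preserving isometry of the cube); a *cube attachment* glues an $i$-cube, along $i$ of its edges at one corner, to $i$ edges that are all incident to one vertex and whose labels form an $i$-clique in $\Gamma$. A complex is *folded* if no fold and no cube identification can be performed on it, and *cube-full* if,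 for any $i$ edges incident to a common vertex whose labels form an $i$-clique in $\Gamma$, some $i$-cube contains these edges in its boundary. A complex is finite if it has finitely many cubes. Let $G\le W_\Gamma$. A *completion* of $G$ is a connected, folded and cube-full $\Gamma$-labeled cube complex $\Omega$ with a base vertex $B$ such that the label of every loop in the $1$-skeleton based at $B$ represents an element of $G$, and every reduced word representing an element of $G$ is the label of some loop based at $B$. For a finite set $T$ of words whose elements generate $G$, let $X(T)$ be the labeled graph which consists of a base vertex and, for each $w\in T$, a circle attached to it, subdivided into $|w|$ edges whose labels spell $w$. A *standard completion* of $G$ is a folded and cube-full complex which is, for some such $T$, the direct limit of a finite or infinite sequence $X(T)=\Omega_0\to\Omega_1\to\Omega_2\to\cdots$ in which each map is a fold, a cube identification or a cube attachment. **Theorem.** For every subgroup $G$ of $W_\Gamma$, the following are equivalent: 1. $G$ is quasiconvex. 2. Some completion of $G$ is finite. 3. $G$ is finitely generated and every standard completion of $G$ is finite. -/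

import Mathlib

universe u

namespace RACG

/-! ### Right-angled Coxeter groups -/

open Classical in
/-- The Coxeter matrix of a simplicial graph `Γ`: `m(s,t)` is `1` if `s = t`, it is `2` if `s` and
`t` are adjacent, and it is `∞` (encoded by `0`) otherwise. -/
noncomputable def coxeterMatrix {V : Type u} (Γ : SimpleGraph V) : CoxeterMatrix V where
  M := Matrix.of fun s t => if s = t then 1 else if Γ.Adj s t then 2 else 0
  isSymm := by
    ext s t
    simp [Matrix.transpose_apply, eq_comm, Γ.adj_comm]
  diagonal s := by simp
  off_diagonal s t h := by
    simp only [Matrix.of_apply, if_neg h]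
    split_ifs <;> norm_num

/-- The right-angled Coxeter group `W_Γ`. -/
abbrev W {V : Type u} (Γ : SimpleGraph V) : Type u := (coxeterMatrix Γ).Group

/-- The standard Coxeter system on `W_Γ`, with generators the vertices of `Γ`. -/
noncomputable abbrev system {V : Type u} (Γ : SimpleGraph V) :
    CoxeterSystem (coxeterMatrix Γ) (W Γ) :=
  (coxeterMatrix Γ).toCoxeterSystem

/-! ### Quasiconvexity -/

/-- A subgroup `G` of a group `H` is `M`-quasiconvex with respect to the generating set `T` if every
geodesic path in the Cayley graph of `(H, T)` with endpoints in `G` lies in the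
`M`-neighbourhood of `G`. -/
def IsQuasiconvexWith {H : Type u} [Group H] (T : Set H) (G : Subgroup H) (M : ℕ) : Prop :=
  ∀ (x y : H) (p : (SimpleGraph.mulCayley T).Walk x y), x ∈ G → y ∈ G →
    p.length = (SimpleGraph.mulCayley T).dist x y →
      ∀ z ∈ p.support, ∃ g ∈ G, (SimpleGraph.mulCayley T).dist z g ≤ M

/-- `G` is quasiconvex in `H` with respect to `T` if it is `M`-quasiconvex for some `M`. -/
def IsQuasiconvex {H : Type u} [Group H] (T : Set H) (G : Subgroup H) : Prop :=
  ∃ M : ℕ, IsQuasiconvexWith T G M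

/-- A subgroup of `W_Γ` is quasiconvex if it is so with respect to the standard generating set. -/
def IsQuasiconvexSubgroup {V : Type u} (Γ : SimpleGraph V) (G : Subgroup (W Γ)) : Prop :=
  IsQuasiconvex (Set.range (system Γ).simple) G

/-! ### Labeled cube complexes -/

/-- A `Γ`-labeled cube complex, in which parallel edges of a cube have the same label and the
edges of a cube at one corner have distinct, pairwise adjacent labels.

Since parallel edges share their label and the labels at a corner are distinct, the directions of
a cube are named by its set of labels `σ`, a finite clique, and the cube is `[-1/2, 1/2]^σ`.
The complex is recorded by its *cornered cubes*: an element of `Cell` is a cube of the complex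
together with a corner of the cube (a vertex of `[-1/2, 1/2]^σ`, before any identification on the
boundary). So an `n`-cube contributes `2^n` elements: a vertex one, and an edge two, which are its
two orientations (pointing away from the chosen corner).

* `labels c` is the set of labels of the cube.
* `flip A c` is the same cube with its corner moved along the directions in `A`. The reflection
  group of a cube acts freely on its corners (`flip_eq_self_iff`).
* `face τ c` is the face at the chosen corner spanned by those directions that belong to `τ`, with
  the same corner. The other faces are `face τ (flip A c)`.

The map from a cube to the complex need not be injective on the boundary; for example an edge may
be a graph-loop. -/
structure CubeComplex {V : Type u} [DecidableEq V] (Γ : SimpleGraph V) where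
  Cell : Type u
  labels : Cell → Finset V
  flip : Finset V → Cell → Cell
  face : Finset V → Cell → Cell
  isClique_labels : ∀ c, Γ.IsClique (labels c : Set V)
  labels_flip : ∀ A c, labels (flip A c) = labels c
  flip_flip : ∀ A B c, flip A (flip B c) = flip (symmDiff A B) c
  flip_eq_self_iff : ∀ A c, flip A c = c ↔ Disjoint A (labels c)
  labels_face : ∀ τ c, labels (face τ c) = labels c ∩ τ
  face_eq_self : ∀ τ c, labels c ⊆ τ → face τ c = c
  face_face : ∀ τ τ' c, face τ (face τ' c) = face (τ ∩ τ') c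
  face_flip : ∀ A τ c, A ⊆ τ → face τ (flip A c) = flip A (face τ c)

namespace CubeComplex

variable {V : Type u} [DecidableEq V] {Γ : SimpleGraph V}

/-- `v` is a vertex (a `0`-cube). -/
def IsVertex (C : CubeComplex Γ) (v : C.Cell) : Prop := C.labels v = ∅

/-- `d` is an oriented edge with label `s`. -/
def IsEdge (C : CubeComplex Γ) (s : V) (d : C.Cell) : Prop := C.labels d = {s}

/-- The corner of a cornered cube, as a vertex of the complex. For an oriented edge this is its
initial vertex. -/
def source (C : CubeComplex Γ) (c : C.Cell) : C.Cell := C.face ∅ c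

/-- The vertex opposite to the corner of a cornered cube. For an oriented edge this is its terminal
vertex. -/
def target (C : CubeComplex Γ) (c : C.Cell) : C.Cell := C.face ∅ (C.flip (C.labels c) c)

/-- Two cornered cubes have the same underlying cube. -/
def SameCube (C : CubeComplex Γ) (c c' : C.Cell) : Prop := ∃ A, c' = C.flip A c

/-- `C.Path u v w`: there is a path in the `1`-skeleton, from the vertex `u` to the vertex `v`,
whose label is the word `w`. -/
inductive Path (C : CubeComplex Γ) : C.Cell → C.Cell → List V → Prop
  | nil (v : C.Cell) (hv : C.IsVertex v) : Path C v v []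
  | cons (s : V) (d : C.Cell) (hd : C.IsEdge s d) (v : C.Cell) (w : List V)
      (h : Path C (C.target d) v w) : Path C (C.source d) v (s :: w)

/-- The complex is finite: it has finitely many cubes. -/
def IsFinite (C : CubeComplex Γ) : Prop := Finite C.Cell

/-- A label-preserving combinatorial map of labeled cube complexes. -/
structure Hom (C D : CubeComplex Γ) where
  toFun : C.Cell → D.Cell
  labels_toFun : ∀ c, D.labels (toFun c) = C.labels c
  toFun_flip : ∀ A c, toFun (C.flip A c) = D.flip A (toFun c)
  toFun_face : ∀ τ c, toFun (C.face τ c) = D.face τ (toFun c)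

/-- The map is an isomorphism of labeled cube complexes. -/
def Hom.IsIso {C D : CubeComplex Γ} (f : Hom C D) : Prop := Function.Bijective f.toFun

/-- The congruence generated by a relation `R` on cornered cubes: the smallest equivalence relation
which contains `R` and is compatible with moving corners and taking faces. -/
inductive Congr (C : CubeComplex Γ) (R : C.Cell → C.Cell → Prop) : C.Cell → C.Cell → Prop
  | of (c c' : C.Cell) (h : R c c') : Congr C R c c'
  | refl (c : C.Cell) : Congr C R c c
  | symm (c c' : C.Cell) (h : Congr C R c c') : Congr C R c' c
  | trans (c c' c'' : C.Cell) (h : Congr C R c c') (h' : Congr C R c' c'') : Congr C R c c''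
  | flip (A : Finset V) (c c' : C.Cell) (h : Congr C R c c') :
      Congr C R (C.flip A c) (C.flip A c')
  | face (τ : Finset V) (c c' : C.Cell) (h : Congr C R c c') :
      Congr C R (C.face τ c) (C.face τ c')

/-- `f : C → D` is the quotient map for the identifications prescribed by `R`. -/
def Hom.IsQuotientMap {C D : CubeComplex Γ} (f : Hom C D) (R : C.Cell → C.Cell → Prop) : Prop :=
  Function.Surjective f.toFun ∧ ∀ c c', f.toFun c = f.toFun c' ↔ C.Congr R c c'

/-! ### The three operations -/

/-- `d` and `e` are oriented edges with the same label and the same initial vertex, whose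
underlying edges are distinct. -/
def Foldable (C : CubeComplex Γ) (d e : C.Cell) : Prop :=
  (∃ s, C.IsEdge s d ∧ C.IsEdge s e) ∧ C.source d = C.source e ∧ ¬ C.SameCube d e

/-- `f` is a fold operation: it identifies two distinct edges with a common endpoint and the same
label, oriented away from that endpoint (a graph-loop may be given either orientation). -/
def Hom.IsFold {C D : CubeComplex Γ} (f : Hom C D) : Prop :=
  ∃ d e : C.Cell, C.Foldable d e ∧ f.IsQuotientMap fun c c' => c = d ∧ c' = e

/-- The two cornered cubes have the same labels and the same attaching map: all their proper faces
coincide. -/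
def SameBoundary (C : CubeComplex Γ) (c c' : C.Cell) : Prop :=
  C.labels c = C.labels c' ∧
    ∀ A τ, τ ⊂ C.labels c → C.face τ (C.flip A c) = C.face τ (C.flip A c')

/-- `c` and `c'` are distinct cubes of the same dimension, at least `2`, whose boundaries are equal
(for the chosen corners). -/
def Identifiable (C : CubeComplex Γ) (c c' : C.Cell) : Prop :=
  2 ≤ (C.labels c).card ∧ C.SameBoundary c c' ∧ ¬ C.SameCube c c'

/-- `f` is a cube identification operation: it identifies all cubes of a collection `K` of two or
more distinct cubes of dimension at least `2` with equal boundaries. -/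
def Hom.IsCubeIdentification {C D : CubeComplex Γ} (f : Hom C D) : Prop :=
  ∃ K : Set C.Cell, K.Nontrivial ∧ K.Pairwise C.Identifiable ∧
    f.IsQuotientMap fun c c' => c ∈ K ∧ c' ∈ K

/-- The disjoint union of two complexes. -/
def sum (C D : CubeComplex Γ) : CubeComplex Γ where
  Cell := C.Cell ⊕ D.Cell
  labels := Sum.elim C.labels D.labels
  flip A := Sum.map (C.flip A) (D.flip A)
  face τ := Sum.map (C.face τ) (D.face τ)
  isClique_labels := by
    rintro (c | c)
    · exact C.isClique_labels c
    · exact D.isClique_labels c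
  labels_flip := by rintro A (c | c) <;> simp [C.labels_flip, D.labels_flip]
  flip_flip := by rintro A B (c | c) <;> simp [C.flip_flip, D.flip_flip]
  flip_eq_self_iff := by rintro A (c | c) <;> simp [C.flip_eq_self_iff, D.flip_eq_self_iff]
  labels_face := by rintro τ (c | c) <;> simp [C.labels_face, D.labels_face]
  face_eq_self := by
    rintro τ (c | c) h
    · exact congrArg Sum.inl (C.face_eq_self τ c h)
    · exact congrArg Sum.inr (D.face_eq_self τ c h)
  face_face := by rintro τ τ' (c | c) <;> simp [C.face_face, D.face_face]
  face_flip := by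
    rintro A τ (c | c) h
    · exact congrArg Sum.inl (C.face_flip A τ c h)
    · exact congrArg Sum.inr (D.face_flip A τ c h)

/-- The standard cube `[-1/2, 1/2]^σ` as a labeled complex. A cornered face is a pair `(τ, P)`: the
directions `τ ⊆ σ` of the face, and its corner, which is the vertex of the cube that differs from
the base corner exactly in the coordinates in `P ⊆ σ`. -/
def stdCube (σ : Finset V) (hσ : Γ.IsClique (σ : Set V)) : CubeComplex Γ where
  Cell := {p : Finset V × Finset V // p.1 ⊆ σ ∧ p.2 ⊆ σ}
  labels c := c.1.1
  flip A c := ⟨(c.1.1, symmDiff c.1.2 (A ∩ c.1.1)), c.2.1, by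
    intro x hx
    rcases Finset.mem_symmDiff.1 hx with h | h
    · exact c.2.2 h.1
    · exact c.2.1 (Finset.mem_inter.1 h.1).2⟩
  face τ c := ⟨(c.1.1 ∩ τ, c.1.2), fun _ hx => c.2.1 (Finset.mem_inter.1 hx).1, c.2.2⟩
  isClique_labels c := hσ.subset (Finset.coe_subset.2 c.2.1)
  labels_flip _ _ := rfl
  flip_flip A B c := by
    apply Subtype.ext
    refine Prod.ext rfl ?_
    ext x
    simp only [Finset.mem_symmDiff, Finset.mem_inter]
    tauto
  flip_eq_self_iff A c := by
    rw [Finset.disjoint_iff_inter_eq_empty]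
    simp only [Subtype.ext_iff, Prod.ext_iff, true_and]
    exact symmDiff_eq_left
  labels_face _ _ := rfl
  face_eq_self τ c h := by
    apply Subtype.ext
    exact Prod.ext (Finset.inter_eq_left.2 h) rfl
  face_face τ τ' c := by
    apply Subtype.ext
    refine Prod.ext ?_ rfl
    ext x
    simp only [Finset.mem_inter]
    tauto
  face_flip A τ c h := by
    apply Subtype.ext
    refine Prod.ext rfl ?_
    ext x
    have := @h x
    simp only [Finset.mem_symmDiff, Finset.mem_inter]
    tauto

/-- The base corner of the standard cube, as a vertex. -/
def stdCube.base (σ : Finset V) (hσ : Γ.IsClique (σ : Set V)) : (stdCube σ hσ).Cell :=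
  ⟨(∅, ∅), Finset.empty_subset σ, Finset.empty_subset σ⟩

/-- The edge of the standard cube with label `s` at the base corner, oriented away from it. -/
def stdCube.edge (σ : Finset V) (hσ : Γ.IsClique (σ : Set V)) (s : V) (hs : s ∈ σ) :
    (stdCube σ hσ).Cell :=
  ⟨({s}, ∅), Finset.singleton_subset_iff.2 hs, Finset.empty_subset σ⟩

/-- `d` is a tuple of edges, indexed by its labels `s ∈ σ`, which are all incident to the
vertex `v`; the edges are oriented away from `v`. -/
def IsStar (C : CubeComplex Γ) (v : C.Cell) (σ : Finset V) (d : V → C.Cell) : Prop :=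
  C.IsVertex v ∧ ∀ s ∈ σ, C.IsEdge s (d s) ∧ C.source (d s) = v

/-- The identifications of a cube attachment, on the disjoint union of `C` and a standard cube: the
base corner of the cube is glued to `v` and its edge with label `s` at the base corner to `d s`. -/
inductive AttachRel (C : CubeComplex Γ) (v : C.Cell) (σ : Finset V)
    (hσ : Γ.IsClique (σ : Set V)) (d : V → C.Cell) :
    (C.sum (stdCube σ hσ)).Cell → (C.sum (stdCube σ hσ)).Cell → Prop
  | vertex : AttachRel C v σ hσ d (Sum.inl v) (Sum.inr (stdCube.base σ hσ))
  | edge (s : V) (hs : s ∈ σ) :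
      AttachRel C v σ hσ d (Sum.inl (d s)) (Sum.inr (stdCube.edge σ hσ s hs))

/-- `f` is a cube attachment operation: it is the inclusion of `C` into the complex obtained by
attaching a cube along edges incident to a single vertex, whose labels form a clique. -/
def Hom.IsCubeAttachment {C D : CubeComplex Γ} (f : Hom C D) : Prop :=
  ∃ (v : C.Cell) (σ : Finset V) (hσ : Γ.IsClique (σ : Set V)) (d : V → C.Cell)
    (q : Hom (C.sum (stdCube σ hσ)) D),
    C.IsStar v σ d ∧ q.IsQuotientMap (C.AttachRel v σ hσ d) ∧
      ∀ c, f.toFun c = q.toFun (Sum.inl c)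

/-! ### Completions -/

/-- No fold operation and no cube identification operation can be performed. -/
def IsFolded (C : CubeComplex Γ) : Prop :=
  (∀ d e, ¬ C.Foldable d e) ∧ ∀ c c', ¬ C.Identifiable c c'

/-- For any tuple of edges incident to the same vertex, whose labels form a clique, there is a cube
of the same dimension whose boundary contains these edges. -/
def IsCubeFull (C : CubeComplex Γ) : Prop :=
  ∀ (v : C.Cell) (σ : Finset V) (d : V → C.Cell), Γ.IsClique (σ : Set V) → C.IsStar v σ d →
    ∃ c, C.labels c = σ ∧ ∀ s ∈ σ, ∃ A, C.face {s} (C.flip A c) = d s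

/-- A sequence `X ≅ Ω₀ → Ω₁ → Ω₂ → ⋯` of fold, cube identification and cube attachment
operations. Isomorphisms are allowed as steps, so that a finite sequence is included as a sequence
that is eventually constant. -/
structure OperationSequence (X : CubeComplex Γ) where
  obj : ℕ → CubeComplex Γ
  map : ∀ n, Hom (obj n) (obj (n + 1))
  init : Hom X (obj 0)
  isIso_init : init.IsIso
  isOperation : ∀ n, (map n).IsFold ∨ (map n).IsCubeIdentification ∨ (map n).IsCubeAttachment ∨
    (map n).IsIso

/-- The composite map `Ω_n → Ω_{n+k}` of the sequence. -/
def OperationSequence.trans {X : CubeComplex Γ} (S : OperationSequence X) (n : ℕ) :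
    ∀ k : ℕ, (S.obj n).Cell → (S.obj (n + k)).Cell
  | 0 => id
  | k + 1 => fun c => (S.map (n + k)).toFun (S.trans n k c)

/-- `Ω`, with the maps `φ n : Ω_n → Ω`, is the direct limit of the sequence. -/
structure OperationSequence.IsDirectLimit {X : CubeComplex Γ} (S : OperationSequence X)
    (Ω : CubeComplex Γ) (φ : ∀ n, Hom (S.obj n) Ω) : Prop where
  compat : ∀ n c, (φ (n + 1)).toFun ((S.map n).toFun c) = (φ n).toFun c
  surj : ∀ c, ∃ n c', (φ n).toFun c' = c
  eq_iff : ∀ n c c', (φ n).toFun c = (φ n).toFun c' ↔ ∃ k, S.trans n k c = S.trans n k c'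

/-- `Ω` is a completion of the complex `X`: a folded and cube-full direct limit of a sequence of
operations starting from `X`. -/
def IsCompletionOfComplex (X Ω : CubeComplex Γ) : Prop :=
  (∃ (S : OperationSequence X) (φ : ∀ n, Hom (S.obj n) Ω), S.IsDirectLimit Ω φ) ∧
    Ω.IsFolded ∧ Ω.IsCubeFull

/-- `(Ω, B)` is a completion of the subgroup `G` of `W_Γ`. -/
structure IsCompletion (G : Subgroup (W Γ)) (Ω : CubeComplex Γ) (B : Ω.Cell) : Prop where
  isVertex : Ω.IsVertex B
  connected : ∀ v, Ω.IsVertex v → ∃ w, Ω.Path B v w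
  isFolded : Ω.IsFolded
  isCubeFull : Ω.IsCubeFull
  loop_mem : ∀ w, Ω.Path B B w → (system Γ).wordProd w ∈ G
  exists_loop : ∀ w, (system Γ).IsReduced w → (system Γ).wordProd w ∈ G → Ω.Path B B w

/-! ### The rose of a finite set of words -/

/-- The cornered cubes of the complex `X(S)` of a finite set `S` of words: the base vertex, the
interior vertices of the circles (the circle of `w` has the interior vertices `0 < j < |w|`), and
the oriented edges: the `j`-th edge of the circle of `w`, from position `j` to position `j + 1`,
traversed in this direction (`fwd = true`) or backwards (`fwd = false`). -/
inductive RoseCell (S : Finset (List V)) : Type u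
  | base : RoseCell S
  | interior (w : List V) (hw : w ∈ S) (j : ℕ) (h0 : 0 < j) (h1 : j < w.length) : RoseCell S
  | edge (w : List V) (hw : w ∈ S) (j : Fin w.length) (fwd : Bool) : RoseCell S

/-- The vertex at position `j` on the circle of `w`; the positions `0` and `|w|` are the base
vertex. -/
def RoseCell.vertex (S : Finset (List V)) (w : List V) (hw : w ∈ S) (j : ℕ) : RoseCell S :=
  if h : 0 < j ∧ j < w.length then .interior w hw j h.1 h.2 else .base

/-- The set of labels of a cell: a vertex has none, and the `j`-th edge of the circle of `w` has the
`j`-th letter of `w`. -/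
def RoseCell.labels {S : Finset (List V)} : RoseCell S → Finset V
  | .base => ∅
  | .interior _ _ _ _ _ => ∅
  | .edge w _ j _ => {w.get j}

/-- Moving the corner along the directions in `A`: an edge is reversed if its label is in `A`. -/
def RoseCell.flip {S : Finset (List V)} (A : Finset V) : RoseCell S → RoseCell S
  | .base => .base
  | .interior w hw j h0 h1 => .interior w hw j h0 h1
  | .edge w hw j fwd => .edge w hw j (if w.get j ∈ A then !fwd else fwd)

/-- Taking a face: an oriented edge is replaced by its initial vertex if its label is not in
`τ`. -/
def RoseCell.face {S : Finset (List V)} (τ : Finset V) : RoseCell S → RoseCell S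
  | .base => .base
  | .interior w hw j h0 h1 => .interior w hw j h0 h1
  | .edge w hw j fwd =>
    if w.get j ∈ τ then .edge w hw j fwd
    else RoseCell.vertex S w hw (if fwd then (j : ℕ) else (j : ℕ) + 1)

theorem RoseCell.labels_vertex {U : Type u} (S : Finset (List U)) (w : List U) (hw : w ∈ S) (j : ℕ) :
    (RoseCell.vertex S w hw j).labels = ∅ := by
  unfold RoseCell.vertex
  split_ifs <;> rfl

theorem RoseCell.flip_vertex (S : Finset (List V)) (w : List V) (hw : w ∈ S) (j : ℕ)
    (A : Finset V) : (RoseCell.vertex S w hw j).flip A = RoseCell.vertex S w hw j := by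
  unfold RoseCell.vertex
  split_ifs <;> rfl

theorem RoseCell.face_vertex (S : Finset (List V)) (w : List V) (hw : w ∈ S) (j : ℕ)
    (τ : Finset V) : (RoseCell.vertex S w hw j).face τ = RoseCell.vertex S w hw j := by
  unfold RoseCell.vertex
  split_ifs <;> rfl

/-- The complex `X(S)` of a finite set `S` of words: a base vertex `B` with, for each `w ∈ S`, a
circle attached at `B` and subdivided into `|w|` edges, whose labels, read from `B`, spell `w`. -/
def rose (Γ : SimpleGraph V) (S : Finset (List V)) : CubeComplex Γ where
  Cell := RoseCell S
  labels := RoseCell.labels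
  flip := RoseCell.flip
  face := RoseCell.face
  isClique_labels c := by
    cases c <;> simp [RoseCell.labels]
  labels_flip A c := by
    cases c <;> rfl
  flip_flip A B c := by
    cases c with
    | base => rfl
    | interior w hw j h0 h1 => rfl
    | edge w hw j fwd =>
      simp only [RoseCell.flip, Finset.mem_symmDiff]
      by_cases hA : w.get j ∈ A <;> by_cases hB : w.get j ∈ B <;> simp_all
  flip_eq_self_iff A c := by
    cases c with
    | base => simp [RoseCell.flip, RoseCell.labels]
    | interior w hw j h0 h1 => simp [RoseCell.flip, RoseCell.labels]
    | edge w hw j fwd =>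
      simp only [RoseCell.flip, RoseCell.labels, Finset.disjoint_singleton_right]
      by_cases hA : w.get j ∈ A <;> simp_all
  labels_face τ c := by
    cases c with
    | base => simp [RoseCell.face, RoseCell.labels]
    | interior w hw j h0 h1 => simp [RoseCell.face, RoseCell.labels]
    | edge w hw j fwd =>
      by_cases hA : w.get j ∈ τ
      · simp only [RoseCell.face, if_pos hA, RoseCell.labels]
        rw [Finset.singleton_inter_of_mem hA]
      · simp only [RoseCell.face, if_neg hA, RoseCell.labels_vertex]
        rw [RoseCell.labels, Finset.singleton_inter_of_notMem hA]
  face_eq_self τ c h := by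
    cases c with
    | base => rfl
    | interior w hw j h0 h1 => rfl
    | edge w hw j fwd =>
      have hA : w.get j ∈ τ := Finset.singleton_subset_iff.1 h
      simp only [RoseCell.face, if_pos hA]
  face_face τ τ' c := by
    cases c with
    | base => rfl
    | interior w hw j h0 h1 => rfl
    | edge w hw j fwd =>
      by_cases hB : w.get j ∈ τ'
      · by_cases hA : w.get j ∈ τ
        · simp only [RoseCell.face, if_pos hB, if_pos hA, if_pos (Finset.mem_inter.2 ⟨hA, hB⟩)]
        · have hAB : w.get j ∉ τ ∩ τ' := fun h => hA (Finset.mem_inter.1 h).1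
          simp only [RoseCell.face, if_pos hB, if_neg hA, if_neg hAB]
      · have hAB : w.get j ∉ τ ∩ τ' := fun h => hB (Finset.mem_inter.1 h).2
        simp only [RoseCell.face, if_neg hB, if_neg hAB]
        exact RoseCell.face_vertex S w hw _ τ
  face_flip A τ c h := by
    cases c with
    | base => rfl
    | interior w hw j h0 h1 => rfl
    | edge w hw j fwd =>
      by_cases hB : w.get j ∈ τ
      · simp only [RoseCell.face, RoseCell.flip, if_pos hB]
      · have hA : w.get j ∉ A := fun h' => hB (h h')
        simp only [RoseCell.face, RoseCell.flip, if_neg hB, if_neg hA]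
        exact (RoseCell.flip_vertex S w hw _ A).symm

/-- `Ω` is a standard completion of `G`: a completion of the complex `X(S)`, for some finite set `S`
of words whose elements generate `G`. -/
def IsStandardCompletion (G : Subgroup (W Γ)) (Ω : CubeComplex Γ) : Prop :=
  ∃ S : Finset (List V),
    Subgroup.closure ((system Γ).wordProd '' (S : Set (List V))) = G ∧
      IsCompletionOfComplex (rose Γ S) Ω

end CubeComplex

end RACG

/-!
All three implications rest on one fact about right-angled Coxeter groups: if two distinct letters
are both possible last letters (descents) of an element, then they are adjacent in `Γ`
(`RACG.adj_of_isRightDescent`), and multiplication by a letter adjacent to `s` does not affect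
whether `s` is a descent (`RACG.isRightDescent_mul_simple_iff`). It is proved by letting `W_Γ` act on
the words without cancellations, up to exchanging neighbouring adjacent letters.

*A finite completion makes `G` quasiconvex.* A reduced word for an element of `G` is the label of a
loop at `B`, and every vertex of a finite connected complex is joined to `B` by a path of bounded
length (`RACG.CubeComplex.IsCompletion.isQuasiconvexSubgroup`).

*Standard completions exist for finitely generated `G`, and are completions.* For the existence, the
folds, cube identifications and cube attachments are dovetailed: the complexes are countable, so the
operations that may be called for at any stage can be enumerated, and each is performed at a later
stage if it is still possible (`RACG.CubeComplex.exists_operationSequence`). The limit is folded and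
cube-full. In a folded and cube-full complex, a path can be replaced by a path along any reduced word
for the same element (`RACG.CubeComplex.IsFolded.path_of_isReduced`), so that every reduced word for
an element of `G` is the label of a loop at the base vertex. Conversely, the rose has a development:
a label-preserving map from its vertices to the `G`-orbits of vertices of the Cayley graph. It
extends along each operation, hence to the limit, and therefore loops at the base vertex represent
elements of `G`.

*If `G` is quasiconvex, then its standard completions are finite.* A development of a completion is
injective on vertices, and a folded complex with finitely many vertices is finite. So it is enough to
confine the development to a finite set of orbits. A cube attachment requires that this set contains
the fourth corner of a square along with the three others. For a suitable radius `r`, the image of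
the rose lies in the set `RACG.CubeComplex.localHull G r` of the vertices all of whose neighbouring
walls have some point of the `r`-neighbourhood of `G` on the same side; and this set is closed in the
required sense (`RACG.CubeComplex.isSquareClosed_localHull`).

The finiteness of the local hull is the heart of the matter
(`RACG.length_le_of_forall_not_isRightDescent`). Let `z` be in it, with `1` a closest point of `G`.
For each descent `s` of `z`, split off from `z` the letters that can be moved behind the last `s`;
what remains is a prefix `m s` of `z` whose only descent is `s`. A point `h * p` of the
neighbourhood on the side of `z` of the wall of `s` has a geodesic from `1` passing through `m s`. By
quasiconvexity, `m s` is close to `G`, and hence short, because `1` is the closest point to `z`.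
The prefixes `m s` lie below a common prefix of length at most the sum of their lengths
(`RACG.IsPrefix.exists_join`), and this prefix is `z` itself, since no descent of `z` is left beyond
it.
-/

namespace RACG

/-! ### Words in a right-angled Coxeter group -/

section Words

variable {V : Type u} (Γ : SimpleGraph V)

/-- Two words are equivalent if they differ by exchanging neighbouring letters that are adjacent
in `Γ`. -/
inductive CommEquiv : List V → List V → Prop
  | nil : CommEquiv [] []
  | cons (a : V) {l l' : List V} (h : CommEquiv l l') : CommEquiv (a :: l) (a :: l')
  | swap (a b : V) (l : List V) (h : Γ.Adj a b) : CommEquiv (a :: b :: l) (b :: a :: l)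
  | trans {l l' l'' : List V} (h : CommEquiv l l') (h' : CommEquiv l' l'') : CommEquiv l l''

open Classical in
/-- Remove from `l` the first occurrence of `s`, provided that all the letters before it are
adjacent to `s`. -/
noncomputable def cancel (s : V) : List V → Option (List V)
  | [] => none
  | a :: l => if a = s then some l else if Γ.Adj s a then (cancel s l).map (a :: ·) else none

/-- No letter of the word can be moved next to an equal letter by exchanging neighbouring letters
that are adjacent in `Γ`. -/
def NoCancel : List V → Prop
  | [] => True
  | a :: l => cancel Γ a l = none ∧ NoCancel l

variable {Γ}

theorem CommEquiv.refl (l : List V) : CommEquiv Γ l l := by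
  induction l with
  | nil => exact .nil
  | cons a l ih => exact .cons a ih

theorem CommEquiv.symm {l l' : List V} (h : CommEquiv Γ l l') : CommEquiv Γ l' l := by
  induction h with
  | nil => exact .nil
  | cons a _ ih => exact .cons a ih
  | swap a b l h => exact .swap b a l h.symm
  | trans _ _ ih ih' => exact .trans ih' ih

theorem CommEquiv.length_eq {l l' : List V} (h : CommEquiv Γ l l') : l.length = l'.length := by
  induction h with
  | nil => rfl
  | cons a _ ih => simp [ih]
  | swap a b l h => rfl
  | trans _ _ ih ih' => exact ih.trans ih'

theorem cancel_cons_self (s : V) (l : List V) : cancel Γ s (s :: l) = some l := by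
  simp [cancel]

theorem cancel_cons_of_adj {s t : V} (h : Γ.Adj s t) (l : List V) :
    cancel Γ s (t :: l) = (cancel Γ s l).map (t :: ·) := by
  simp [cancel, h, h.ne']

theorem CommEquiv.cancel {l l' : List V} (h : CommEquiv Γ l l') (s : V) :
    ∀ m, RACG.cancel Γ s l = some m → ∃ m', RACG.cancel Γ s l' = some m' ∧ CommEquiv Γ m m' := by
  induction h with
  | nil => intro m hm; simp [RACG.cancel] at hm
  | @cons a l l' h ih =>
    intro m hm
    by_cases has : a = s
    · subst has
      rw [cancel_cons_self] at hm ⊢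
      cases hm
      exact ⟨_, rfl, h⟩
    · by_cases hadj : Γ.Adj s a
      · rw [cancel_cons_of_adj hadj] at hm ⊢
        obtain ⟨k, hk, rfl⟩ := Option.map_eq_some_iff.1 hm
        obtain ⟨k', hk', e⟩ := ih k hk
        exact ⟨a :: k', by simp [hk'], .cons a e⟩
      · simp [RACG.cancel, has, hadj] at hm
  | swap a b l h =>
    intro m hm
    by_cases has : a = s
    · subst has
      rw [cancel_cons_self] at hm
      cases hm
      rw [cancel_cons_of_adj h, cancel_cons_self]
      exact ⟨_, rfl, .refl _⟩
    · by_cases hbs : b = s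
      · subst hbs
        rw [cancel_cons_self]
        rw [cancel_cons_of_adj h.symm, cancel_cons_self] at hm
        cases hm
        exact ⟨_, rfl, .refl _⟩
      · by_cases ha : Γ.Adj s a <;> by_cases hb : Γ.Adj s b <;>
          simp [RACG.cancel, has, hbs, ha, hb] at hm ⊢
        obtain ⟨k, hk, rfl⟩ := hm
        exact ⟨k, hk, .swap a b k h⟩
  | trans _ _ ih ih' =>
    intro m hm
    obtain ⟨m', hm', e⟩ := ih m hm
    obtain ⟨m'', hm'', e'⟩ := ih' m' hm'
    exact ⟨m'', hm'', e.trans e'⟩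

theorem CommEquiv.cancel_eq_none {l l' : List V} (h : CommEquiv Γ l l') {s : V}
    (hs : RACG.cancel Γ s l = none) : RACG.cancel Γ s l' = none := by
  rw [Option.eq_none_iff_forall_ne_some]
  intro m hm
  obtain ⟨m', hm', -⟩ := h.symm.cancel s m hm
  simp [hs] at hm'

theorem commEquiv_of_cancel_eq_some {s : V} :
    ∀ {l m : List V}, cancel Γ s l = some m → CommEquiv Γ l (s :: m)
  | [], m, h => by simp [cancel] at h
  | a :: l, m, h => by
    by_cases has : a = s
    · subst has
      rw [cancel_cons_self] at h
      cases h
      exact .refl _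
    · by_cases hadj : Γ.Adj s a
      · rw [cancel_cons_of_adj hadj] at h
        obtain ⟨k, hk, rfl⟩ := Option.map_eq_some_iff.1 h
        exact (CommEquiv.cons a (commEquiv_of_cancel_eq_some hk)).trans (.swap a s k hadj.symm)
      · simp [cancel, has, hadj] at h

theorem NoCancel.of_cancel {s : V} : ∀ {l m : List V}, NoCancel Γ l → cancel Γ s l = some m →
    NoCancel Γ m ∧ cancel Γ s m = none
  | [], m, _, h => by simp [cancel] at h
  | a :: l, m, hl, h => by
    by_cases has : a = s
    · subst has
      rw [cancel_cons_self] at h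
      cases h
      exact ⟨hl.2, hl.1⟩
    · by_cases hadj : Γ.Adj s a
      · rw [cancel_cons_of_adj hadj] at h
        obtain ⟨k, hk, rfl⟩ := Option.map_eq_some_iff.1 h
        obtain ⟨hk', hsk⟩ := NoCancel.of_cancel hl.2 hk
        refine ⟨⟨?_, hk'⟩, by rw [cancel_cons_of_adj hadj, hsk]; rfl⟩
        have := (commEquiv_of_cancel_eq_some hk).cancel_eq_none hl.1
        rw [cancel_cons_of_adj hadj.symm] at this
        simpa using this
      · simp [cancel, has, hadj] at h

/-- Two letters that can both be moved to the front of a word are equal or adjacent. -/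
theorem adj_of_cancel {s t : V} (hst : s ≠ t) : ∀ {l m k : List V}, cancel Γ s l = some m →
    cancel Γ t l = some k → Γ.Adj s t
  | [], _, _, h, _ => by simp [cancel] at h
  | a :: l, m, k, hs, ht => by
    by_cases has : a = s
    · subst has
      by_cases hadj : Γ.Adj t a
      · exact hadj.symm
      · simp [cancel, hst, hadj] at ht
    · by_cases hat : a = t
      · subst hat
        by_cases hadj : Γ.Adj s a
        · exact hadj
        · simp [cancel, has, hadj] at hs
      · by_cases h1 : Γ.Adj s a
        · by_cases h2 : Γ.Adj t a
          · rw [cancel_cons_of_adj h1] at hs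
            rw [cancel_cons_of_adj h2] at ht
            obtain ⟨m', hm', -⟩ := Option.map_eq_some_iff.1 hs
            obtain ⟨k', hk', -⟩ := Option.map_eq_some_iff.1 ht
            exact adj_of_cancel hst hm' hk'
          · simp [cancel, hat, h2] at ht
        · simp [cancel, has, h1] at hs

variable (Γ) in
/-- Multiply a word without cancellations by the letter `s` on the left, and cancel `s` if
possible. -/
noncomputable def letterMul (s : V) (l : List V) : List V := (cancel Γ s l).getD (s :: l)

theorem letterMul_of_some {s : V} {l m : List V} (h : cancel Γ s l = some m) :
    letterMul Γ s l = m := by simp [letterMul, h]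

theorem letterMul_of_none {s : V} {l : List V} (h : cancel Γ s l = none) :
    letterMul Γ s l = s :: l := by simp [letterMul, h]

theorem NoCancel.letterMul {l : List V} (hl : NoCancel Γ l) (s : V) :
    NoCancel Γ (RACG.letterMul Γ s l) := by
  cases h : RACG.cancel Γ s l with
  | none => rw [letterMul_of_none h]; exact ⟨h, hl⟩
  | some m => rw [letterMul_of_some h]; exact (hl.of_cancel h).1

theorem CommEquiv.letterMul {l l' : List V} (h : CommEquiv Γ l l') (s : V) :
    CommEquiv Γ (RACG.letterMul Γ s l) (RACG.letterMul Γ s l') := by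
  cases hs : RACG.cancel Γ s l with
  | none =>
    rw [letterMul_of_none hs, letterMul_of_none (h.cancel_eq_none hs)]
    exact .cons s h
  | some m =>
    obtain ⟨m', hm', e⟩ := h.cancel s m hs
    rwa [letterMul_of_some hs, letterMul_of_some hm']

theorem letterMul_letterMul_self {l : List V} (hl : NoCancel Γ l) (s : V) :
    CommEquiv Γ (letterMul Γ s (letterMul Γ s l)) l := by
  cases h : cancel Γ s l with
  | none =>
    rw [letterMul_of_none h, letterMul_of_some (cancel_cons_self s l)]
    exact .refl _
  | some m =>
    rw [letterMul_of_some h, letterMul_of_none (hl.of_cancel h).2]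
    exact (commEquiv_of_cancel_eq_some h).symm

theorem letterMul_comm {s t : V} (hst : Γ.Adj s t) (l : List V) :
    CommEquiv Γ (letterMul Γ s (letterMul Γ t l)) (letterMul Γ t (letterMul Γ s l)) := by
  cases ht : cancel Γ t l with
  | some m =>
    have e := commEquiv_of_cancel_eq_some ht
    refine CommEquiv.trans ?_ ((e.letterMul s).letterMul t).symm
    rw [letterMul_of_some ht]
    have h1 := cancel_cons_of_adj hst m
    cases hs : cancel Γ s m with
    | none =>
      rw [hs] at h1
      have h2 : cancel Γ t (s :: t :: m) = some (s :: m) := by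
        rw [cancel_cons_of_adj hst.symm, cancel_cons_self]; rfl
      rw [letterMul_of_none hs, letterMul_of_none h1, letterMul_of_some h2]
      exact .refl _
    | some n =>
      rw [hs] at h1
      rw [letterMul_of_some hs, letterMul_of_some h1]
      simp only [letterMul_of_some (cancel_cons_self t n)]
      exact .refl _
  | none =>
    rw [letterMul_of_none ht]
    have h1 := cancel_cons_of_adj hst l
    cases hs : cancel Γ s l with
    | none =>
      rw [hs] at h1
      have h2 := cancel_cons_of_adj hst.symm l
      rw [ht] at h2
      rw [letterMul_of_none h1, letterMul_of_none hs, letterMul_of_none h2]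
      exact .swap s t l hst
    | some k =>
      rw [hs] at h1
      have h2 := (commEquiv_of_cancel_eq_some hs).cancel_eq_none ht
      rw [cancel_cons_of_adj hst.symm, Option.map_eq_none_iff] at h2
      rw [letterMul_of_some h1, letterMul_of_some hs, letterMul_of_none h2]
      exact .refl _

variable (Γ) in
/-- The equivalence relation `CommEquiv` on the words without cancellations. -/
def normalWordSetoid : Setoid {l : List V // NoCancel Γ l} where
  r l l' := CommEquiv Γ l.1 l'.1
  iseqv := ⟨fun _ => .refl _, .symm, .trans⟩

variable (Γ) in
/-- The action of a generator on classes of words without cancellations. -/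
noncomputable def letterAction (s : V) : Function.End (Quotient (normalWordSetoid Γ)) :=
  Quotient.map' (s₁ := normalWordSetoid Γ) (s₂ := normalWordSetoid Γ)
    (fun l => ⟨letterMul Γ s l.1, l.2.letterMul s⟩) fun _ _ h => CommEquiv.letterMul h s

theorem letterAction_mk (s : V) (l : {l : List V // NoCancel Γ l}) :
    letterAction Γ s (Quotient.mk _ l) = Quotient.mk _ ⟨letterMul Γ s l.1, l.2.letterMul s⟩ := rfl

theorem coxeterMatrix_of_adj {s t : V} (h : Γ.Adj s t) : coxeterMatrix Γ s t = 2 := by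
  change (Matrix.of _) s t = 2
  simp [h, h.ne]

theorem isLiftable_letterAction : (coxeterMatrix Γ).IsLiftable (letterAction Γ) := by
  intro s t
  by_cases hst : s = t
  · subst hst
    rw [(coxeterMatrix Γ).diagonal, pow_one]
    funext x
    induction x using Quotient.ind with
    | _ l => exact Quotient.sound (letterMul_letterMul_self l.2 s)
  · by_cases hadj : Γ.Adj s t
    · rw [coxeterMatrix_of_adj hadj, pow_two]
      have hc : letterAction Γ s * letterAction Γ t = letterAction Γ t * letterAction Γ s := by
        funext x
        induction x using Quotient.ind with
        | _ l => exact Quotient.sound (letterMul_comm hadj l.1)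
      have hsq : ∀ r, letterAction Γ r * letterAction Γ r = 1 := by
        intro r
        funext x
        induction x using Quotient.ind with
        | _ l => exact Quotient.sound (letterMul_letterMul_self l.2 r)
      calc _ = letterAction Γ s * (letterAction Γ t * letterAction Γ s) * letterAction Γ t := by
            simp only [mul_assoc]
        _ = (letterAction Γ s * letterAction Γ s) * (letterAction Γ t * letterAction Γ t) := by
            rw [← hc]; simp only [mul_assoc]
        _ = 1 := by rw [hsq, hsq, one_mul]
    · have h0 : coxeterMatrix Γ s t = 0 := by
        change (Matrix.of _) s t = 0
        simp [hst, hadj]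
      rw [h0, pow_zero]

variable (Γ) in
/-- The action of `W_Γ` on classes of words without cancellations. -/
noncomputable def normalAction : W Γ →* Function.End (Quotient (normalWordSetoid Γ)) :=
  (system Γ).lift ⟨letterAction Γ, isLiftable_letterAction⟩

/-- The class of a word without cancellations is recovered from the group element it represents, by
acting on the class of the empty word. -/
theorem normalAction_wordProd {l : List V} (hl : NoCancel Γ l) :
    normalAction Γ ((system Γ).wordProd l) (Quotient.mk _ ⟨[], trivial⟩) = Quotient.mk _ ⟨l, hl⟩ := by
  induction l with
  | nil => simp only [CoxeterSystem.wordProd_nil, map_one]; rfl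
  | cons a l ih =>
    have hmul : ∀ (x y : W Γ) (q : Quotient (normalWordSetoid Γ)),
        normalAction Γ (x * y) q = normalAction Γ x (normalAction Γ y q) :=
      fun x y q => by rw [map_mul]; rfl
    rw [CoxeterSystem.wordProd_cons, hmul, ih hl.2, normalAction, CoxeterSystem.lift_apply_simple,
      letterAction_mk]
    congr 2
    exact letterMul_of_none hl.1

theorem simple_comm {s t : V} (h : Γ.Adj s t) :
    (system Γ).simple s * (system Γ).simple t = (system Γ).simple t * (system Γ).simple s := by
  have := (system Γ).simple_mul_simple_pow s t
  rw [coxeterMatrix_of_adj h, pow_two] at this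
  have h2 := eq_inv_of_mul_eq_one_left this
  rw [h2, mul_inv_rev, CoxeterSystem.inv_simple, CoxeterSystem.inv_simple]

theorem CommEquiv.wordProd_eq {l l' : List V} (h : CommEquiv Γ l l') :
    (system Γ).wordProd l = (system Γ).wordProd l' := by
  induction h with
  | nil => rfl
  | cons a _ ih => rw [CoxeterSystem.wordProd_cons, CoxeterSystem.wordProd_cons, ih]
  | swap a b l h =>
    simp only [CoxeterSystem.wordProd_cons, ← mul_assoc, simple_comm h]
  | trans _ _ ih ih' => exact ih.trans ih'

theorem wordProd_of_cancel {s : V} {l m : List V} (h : cancel Γ s l = some m) :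
    (system Γ).wordProd l = (system Γ).simple s * (system Γ).wordProd m := by
  rw [(commEquiv_of_cancel_eq_some h).wordProd_eq, CoxeterSystem.wordProd_cons]

theorem length_of_cancel {s : V} {l m : List V} (h : cancel Γ s l = some m) :
    l.length = m.length + 1 := (commEquiv_of_cancel_eq_some h).length_eq

theorem noCancel_of_isReduced : ∀ {l : List V}, (system Γ).IsReduced l → NoCancel Γ l
  | [], _ => trivial
  | a :: l, h => by
    refine ⟨?_, noCancel_of_isReduced (h.drop 1)⟩
    rw [Option.eq_none_iff_forall_ne_some]
    intro m hm
    have h1 : (system Γ).length ((system Γ).wordProd (a :: l)) = l.length + 1 := h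
    rw [CoxeterSystem.wordProd_cons, wordProd_of_cancel hm,
      CoxeterSystem.simple_mul_simple_cancel_left] at h1
    have h2 := (system Γ).length_wordProd_le m
    have h3 := length_of_cancel hm
    omega

theorem NoCancel.commEquiv {l l' : List V} (h : NoCancel Γ l) (h' : NoCancel Γ l')
    (e : (system Γ).wordProd l = (system Γ).wordProd l') : CommEquiv Γ l l' := by
  have h1 := normalAction_wordProd h
  rw [e, normalAction_wordProd h'] at h1
  exact (Quotient.exact h1).symm

theorem NoCancel.isReduced {l : List V} (h : NoCancel Γ l) : (system Γ).IsReduced l := by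
  obtain ⟨l', hl', e⟩ := (system Γ).exists_isReduced ((system Γ).wordProd l)
  have := (h.commEquiv (noCancel_of_isReduced hl') e).length_eq
  rw [CoxeterSystem.IsReduced, e, hl'.eq, this]

theorem isLeftDescent_wordProd_iff {l : List V} (h : NoCancel Γ l) {s : V} :
    (system Γ).IsLeftDescent ((system Γ).wordProd l) s ↔ ∃ m, cancel Γ s l = some m := by
  cases hs : cancel Γ s l with
  | none =>
    have h1 : NoCancel Γ (s :: l) := ⟨hs, h⟩
    have h2 := h1.isReduced.eq
    rw [CoxeterSystem.wordProd_cons] at h2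
    rw [CoxeterSystem.IsLeftDescent, h2, h.isReduced.eq]
    simp
  | some m =>
    have h1 := length_of_cancel hs
    have h2 := (system Γ).length_wordProd_le m
    have h3 := h.isReduced.eq
    simp only [Option.some.injEq, exists_eq', iff_true]
    rw [CoxeterSystem.IsLeftDescent, h3]
    rw [wordProd_of_cancel hs, CoxeterSystem.simple_mul_simple_cancel_left]
    omega

/-- Distinct right descents of an element of a right-angled Coxeter group are adjacent. -/
theorem adj_of_isRightDescent {x : W Γ} {s t : V} (hst : s ≠ t)
    (hs : (system Γ).IsRightDescent x s) (ht : (system Γ).IsRightDescent x t) : Γ.Adj s t := by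
  rw [← CoxeterSystem.isLeftDescent_inv_iff] at hs ht
  obtain ⟨l, hl, e⟩ := (system Γ).exists_isReduced x⁻¹
  have hn := noCancel_of_isReduced hl
  rw [e, isLeftDescent_wordProd_iff hn] at hs ht
  obtain ⟨m, hm⟩ := hs
  obtain ⟨k, hk⟩ := ht
  exact adj_of_cancel hst hm hk

theorem IsRightDescent.mul_simple {x : W Γ} {s t : V} (hst : Γ.Adj s t)
    (hs : (system Γ).IsRightDescent x s) :
    (system Γ).IsRightDescent (x * (system Γ).simple t) s := by
  rw [← CoxeterSystem.isLeftDescent_inv_iff] at hs ⊢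
  rw [mul_inv_rev, CoxeterSystem.inv_simple]
  obtain ⟨l, hl, e⟩ := (system Γ).exists_isReduced x⁻¹
  have hn := noCancel_of_isReduced hl
  rw [e, isLeftDescent_wordProd_iff hn] at hs
  obtain ⟨m, hm⟩ := hs
  rw [e]
  cases ht : cancel Γ t l with
  | none =>
    rw [← CoxeterSystem.wordProd_cons, isLeftDescent_wordProd_iff (l := t :: l) ⟨ht, hn⟩,
      cancel_cons_of_adj hst, hm]
    exact ⟨_, rfl⟩
  | some k =>
    obtain ⟨m', hm', -⟩ := (commEquiv_of_cancel_eq_some ht).cancel s m hm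
    rw [cancel_cons_of_adj hst, Option.map_eq_some_iff] at hm'
    obtain ⟨n, hn', -⟩ := hm'
    rw [wordProd_of_cancel ht, CoxeterSystem.simple_mul_simple_cancel_left,
      isLeftDescent_wordProd_iff (hn.of_cancel ht).1]
    exact ⟨n, hn'⟩

/-- Multiplication by a generator adjacent to `s` does not affect whether `s` is a descent. -/
theorem isRightDescent_mul_simple_iff {x : W Γ} {s t : V} (hst : Γ.Adj s t) :
    (system Γ).IsRightDescent (x * (system Γ).simple t) s ↔ (system Γ).IsRightDescent x s := by
  refine ⟨fun h => ?_, fun h => IsRightDescent.mul_simple hst h⟩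
  have := IsRightDescent.mul_simple hst h
  rwa [CoxeterSystem.simple_mul_simple_cancel_right] at this

theorem wordProd_append_singleton (w : List V) (s : V) :
    (system Γ).wordProd (w ++ [s]) = (system Γ).wordProd w * (system Γ).simple s := by
  rw [CoxeterSystem.wordProd_append, CoxeterSystem.wordProd_singleton]

theorem wordProd_append_singleton_mul_simple (w : List V) (s : V) :
    (system Γ).wordProd (w ++ [s]) * (system Γ).simple s = (system Γ).wordProd w := by
  rw [wordProd_append_singleton, CoxeterSystem.simple_mul_simple_cancel_right]

end Words

/-! ### Geodesics in a right-angled Coxeter group -/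

section Geodesics

variable {V : Type u} {Γ : SimpleGraph V}

local notation "ℓ" => CoxeterSystem.length (system _)

attribute [-simp] CoxeterMatrix.toCoxeterSystem_simple

local notation "Desc" => CoxeterSystem.IsRightDescent (system _)

/-- `a` lies on a geodesic from `1` to `z`. -/
def IsPrefix (a z : W Γ) : Prop := ℓ z = ℓ a + ℓ (a⁻¹ * z)

theorem length_le_add (a z : W Γ) : ℓ z ≤ ℓ a + ℓ (a⁻¹ * z) := by
  simpa using (system Γ).length_mul_le a (a⁻¹ * z)

theorem length_inv_mul_le (a b c : W Γ) : ℓ (a⁻¹ * c) ≤ ℓ (a⁻¹ * b) + ℓ (b⁻¹ * c) := by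
  simpa [mul_assoc] using (system Γ).length_mul_le (a⁻¹ * b) (b⁻¹ * c)

theorem length_inv_mul_comm (a b : W Γ) : ℓ (a⁻¹ * b) = ℓ (b⁻¹ * a) := by
  rw [← CoxeterSystem.length_inv]; simp

theorem IsPrefix.one (z : W Γ) : IsPrefix 1 z := by simp [IsPrefix]

theorem IsPrefix.refl (z : W Γ) : IsPrefix z z := by simp [IsPrefix]

theorem IsPrefix.trans {a b c : W Γ} (h : IsPrefix a b) (h' : IsPrefix b c) : IsPrefix a c := by
  have h1 := length_inv_mul_le a b c
  have h2 := length_le_add a c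
  unfold IsPrefix at *
  omega

theorem IsPrefix.length_inv_mul {a b c : W Γ} (h : IsPrefix a b) (h' : IsPrefix b c) :
    ℓ (a⁻¹ * c) = ℓ (a⁻¹ * b) + ℓ (b⁻¹ * c) := by
  have h1 := length_inv_mul_le a b c
  have h2 := h.trans h'
  unfold IsPrefix at *
  omega

theorem isPrefix_mul_simple {z : W Γ} {t : V} (h : Desc z t) :
    IsPrefix (z * (system Γ).simple t) z := by
  rw [CoxeterSystem.isRightDescent_iff] at h
  simp [IsPrefix, h]

/-- Exchange property: a descent of a reduced product `u * v` that is not a descent of `v` comes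
from a descent of `u` that commutes with `v`. -/
theorem isRightDescent_of_mul {u v : W Γ} {a : V} (h : ℓ (u * v) = ℓ u + ℓ v)
    (ha : Desc (u * v) a) (hv : ¬ Desc v a) :
    Desc u a ∧ (system Γ).simple a * v = v * (system Γ).simple a := by
  induction hn : ℓ v generalizing v with
  | zero =>
    rw [CoxeterSystem.length_eq_zero_iff] at hn
    subst hn
    simpa using ha
  | succ n ih =>
    have hv1 : v ≠ 1 := by rintro rfl; simp at hn
    obtain ⟨b, hb⟩ := (system Γ).exists_rightDescent_of_ne_one hv1
    have hb' := (system Γ).isRightDescent_iff.1 hb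
    have hab : a ≠ b := by rintro rfl; exact hv hb
    have h1 := (system Γ).length_mul_le u (v * (system Γ).simple b)
    have h2 := (system Γ).length_mul_simple (u * v) b
    rw [← mul_assoc] at h1
    have hub : Desc (u * v) b := by
      rw [CoxeterSystem.isRightDescent_iff]; omega
    have hadj := adj_of_isRightDescent hab ha hub
    have h3 : Desc (u * (v * (system Γ).simple b)) a := by
      rw [← mul_assoc]; exact IsRightDescent.mul_simple hadj ha
    have h4 : ¬ Desc (v * (system Γ).simple b) a := by
      rwa [isRightDescent_mul_simple_iff hadj]
    obtain ⟨h5, h6⟩ := ih (by rw [← mul_assoc]; omega) h3 h4 (by omega)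
    refine ⟨h5, ?_⟩
    rw [← mul_assoc, mul_assoc v, ← simple_comm hadj, ← mul_assoc] at h6
    exact mul_right_cancel h6

theorem isLeftDescent_of_mul {u v : W Γ} {a : V} (h : ℓ (u * v) = ℓ u + ℓ v)
    (ha : (system Γ).IsLeftDescent (u * v) a) (hu : ¬ (system Γ).IsLeftDescent u a) :
    (system Γ).IsLeftDescent v a ∧ (system Γ).simple a * u = u * (system Γ).simple a := by
  rw [← CoxeterSystem.isRightDescent_inv_iff] at *
  rw [mul_inv_rev] at ha
  have h' : ℓ (v⁻¹ * u⁻¹) = ℓ v⁻¹ + ℓ u⁻¹ := by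
    rw [← mul_inv_rev]; simp only [CoxeterSystem.length_inv]; omega
  obtain ⟨h1, h2⟩ := isRightDescent_of_mul h' ha hu
  refine ⟨h1, ?_⟩
  have := congrArg (·⁻¹) h2
  simpa using this.symm

/-- If the only possible first letter `s` of `v` is not a possible last letter of `u`, then nothing
cancels in the product `u * v`. -/
theorem length_mul_of_forall_isLeftDescent {u v : W Γ} {s : V}
    (hv : ∀ t, (system Γ).IsLeftDescent v t → t = s) (hu : ¬ Desc u s) :
    ℓ (u * v) = ℓ u + ℓ v := by
  induction hn : ℓ v generalizing v with
  | zero =>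
    rw [CoxeterSystem.length_eq_zero_iff] at hn
    subst hn
    simp
  | succ n ih =>
    have hv1 : v ≠ 1 := by rintro rfl; simp at hn
    obtain ⟨a, ha⟩ := (system Γ).exists_rightDescent_of_ne_one hv1
    have ha' := (system Γ).isRightDescent_iff.1 ha
    obtain ⟨v', rfl⟩ : ∃ v', v = v' * (system Γ).simple a := ⟨v * (system Γ).simple a, by simp⟩
    simp only [CoxeterSystem.simple_mul_simple_cancel_right] at ha'
    have h1 : ∀ t, (system Γ).IsLeftDescent v' t → t = s := by
      intro t ht
      refine hv t ?_
      have := (system Γ).length_mul_le ((system Γ).simple t * v') ((system Γ).simple a)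
      rw [CoxeterSystem.length_simple, mul_assoc] at this
      unfold CoxeterSystem.IsLeftDescent at *
      omega
    have h2 := ih h1 (by omega)
    rw [← mul_assoc]
    rcases (system Γ).length_mul_simple (u * v') a with h3 | h3
    · omega
    · exfalso
      have h4 : Desc (u * v') a := (system Γ).isRightDescent_iff.2 h3
      have h5 : ¬ Desc v' a := (system Γ).not_isRightDescent_iff.2 ha'.symm
      obtain ⟨h6, h7⟩ := isRightDescent_of_mul (by omega) h4 h5
      have h8 : a = s := hv a (by
        rw [CoxeterSystem.IsLeftDescent, ← h7, CoxeterSystem.simple_mul_simple_cancel_left]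
        rw [h7]
        omega)
      exact hu (h8 ▸ h6)

/-- Two points on geodesics from `1` to `z` lie on a common geodesic to a point that is not much
further from `1`. -/
theorem IsPrefix.exists_join {a b z : W Γ} (ha : IsPrefix a z) (hb : IsPrefix b z) :
    ∃ c, IsPrefix c z ∧ IsPrefix a c ∧ IsPrefix b c ∧ ℓ c ≤ ℓ a + ℓ b := by
  induction hn : ℓ b generalizing b with
  | zero =>
    rw [CoxeterSystem.length_eq_zero_iff] at hn
    subst hn
    exact ⟨a, ha, .refl a, .one a, le_rfl⟩
  | succ n ih =>
    have hb1 : b ≠ 1 := by rintro rfl; simp at hn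
    obtain ⟨t, ht⟩ := (system Γ).exists_rightDescent_of_ne_one hb1
    have ht' := (system Γ).isRightDescent_iff.1 ht
    obtain ⟨b', rfl⟩ : ∃ b', b = b' * (system Γ).simple t := ⟨b * (system Γ).simple t, by simp⟩
    simp only [CoxeterSystem.simple_mul_simple_cancel_right] at ht'
    have hb'b : IsPrefix b' (b' * (system Γ).simple t) := by simpa using isPrefix_mul_simple ht
    obtain ⟨c', hc'z, hac', hbc', hlen⟩ := ih (hb'b.trans hb) (by omega)
    set e := b'⁻¹ * c' with he
    set f := c'⁻¹ * z with hf
    have hef : e * f = b'⁻¹ * z := by simp [he, hf, mul_assoc]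
    have hlef : ℓ (e * f) = ℓ e + ℓ f := hef ▸ hbc'.length_inv_mul hc'z
    have htef : (system Γ).IsLeftDescent (e * f) t := by
      have h1 := hb'b.length_inv_mul hb
      have h2 : ((b' * (system Γ).simple t)⁻¹ * z) = (system Γ).simple t * (e * f) := by
        simp [hef, mul_assoc]
      rw [h2] at h1
      simp only [inv_mul_cancel_left, CoxeterSystem.length_simple] at h1
      rw [CoxeterSystem.IsLeftDescent, hef] at *
      omega
    have hbt : ∀ x : W Γ, (b' * (system Γ).simple t)⁻¹ * x = (system Γ).simple t * (b'⁻¹ * x) := by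
      intro x; simp [mul_assoc]
    by_cases hte : (system Γ).IsLeftDescent e t
    · refine ⟨c', hc'z, hac', ?_, by omega⟩
      have := (system Γ).isLeftDescent_iff.1 hte
      unfold IsPrefix at hbc' ⊢
      rw [hbt, ← he]
      rw [← he] at hbc'
      omega
    · obtain ⟨h1, h2⟩ := isLeftDescent_of_mul hlef htef hte
      have h3 := (system Γ).isLeftDescent_iff.1 h1
      have h4 : (c' * (system Γ).simple t)⁻¹ * z = (system Γ).simple t * f := by
        simp [hf, mul_assoc]
      have h5 := length_le_add (c' * (system Γ).simple t) z
      rw [h4] at h5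
      have h6 := (system Γ).length_mul_simple c' t
      have h7 : ℓ z = ℓ c' + ℓ f := hc'z
      have h8 : ℓ (c' * (system Γ).simple t) = ℓ c' + 1 := by omega
      have h9 : IsPrefix c' (c' * (system Γ).simple t) := by
        simp [IsPrefix, h8]
      refine ⟨c' * (system Γ).simple t, ?_, hac'.trans h9, ?_, by omega⟩
      · unfold IsPrefix
        rw [h4]
        omega
      · have h10 : (system Γ).simple t * (b'⁻¹ * (c' * (system Γ).simple t)) = e := by
          rw [← mul_assoc b'⁻¹, ← he, ← h2, CoxeterSystem.simple_mul_simple_cancel_left]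
        unfold IsPrefix at hbc' ⊢
        rw [hbt, h10, h8]
        rw [← he] at hbc'
        omega

theorem exists_join_of_forall_isPrefix {z : W Γ} (m : V → W Γ) (S : Finset V)
    (h : ∀ s ∈ S, IsPrefix (m s) z) :
    ∃ c, IsPrefix c z ∧ (∀ s ∈ S, IsPrefix (m s) c) ∧ ℓ c ≤ ∑ s ∈ S, ℓ (m s) := by
  classical
  induction S using Finset.induction_on with
  | empty => exact ⟨1, .one z, by simp, by simp⟩
  | insert a S ha ih =>
    obtain ⟨c, hc, hS, hl⟩ := ih fun s hs => h s (Finset.mem_insert_of_mem hs)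
    obtain ⟨c', hc', h1, h2, h3⟩ := (h a (Finset.mem_insert_self a S)).exists_join hc
    refine ⟨c', hc', ?_, by rw [Finset.sum_insert ha]; omega⟩
    intro s hs
    rcases Finset.mem_insert.1 hs with rfl | hs
    · exact h1
    · exact (hS s hs).trans h2

theorem isRightDescent_mul_wordProd_iff {s : V} {l : List V} (hl : ∀ a ∈ l, Γ.Adj s a) (x : W Γ) :
    Desc (x * (system Γ).wordProd l) s ↔ Desc x s := by
  induction l generalizing x with
  | nil => simp
  | cons a l ih =>
    rw [CoxeterSystem.wordProd_cons, ← mul_assoc, ih (fun b hb => hl b (by simp [hb])),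
      isRightDescent_mul_simple_iff (hl a (by simp))]

/-- Given a descent `s` of `z`, the letters that can be moved behind the last `s` are split off, and
`s` remains as the only descent. -/
theorem exists_eq_mul_of_isRightDescent {z : W Γ} {s : V} (hs : Desc z s) :
    ∃ (m : W Γ) (l : List V), (∀ a ∈ l, Γ.Adj s a) ∧ z = m * (system Γ).wordProd l ∧
      IsPrefix m z ∧ ∀ t, Desc m t → t = s := by
  induction hn : ℓ z using Nat.strong_induction_on generalizing z with
  | _ n ih =>
    by_cases h : ∀ t, Desc z t → t = s
    · exact ⟨z, [], by simp, by simp, .refl z, h⟩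
    · push Not at h
      obtain ⟨t, ht, hts⟩ := h
      have hadj := adj_of_isRightDescent hts.symm hs ht
      obtain ⟨m, l, hl, hz, hm, hd⟩ := ih _ (hn ▸ ht) (IsRightDescent.mul_simple hadj hs) rfl
      refine ⟨m, l.concat t, ?_, ?_, hm.trans (isPrefix_mul_simple ht), hd⟩
      · intro a ha
        rw [List.concat_eq_append, List.mem_append, List.mem_singleton] at ha
        rcases ha with ha | rfl
        · exact hl a ha
        · exact hadj
      · rw [CoxeterSystem.wordProd_concat, ← mul_assoc, ← hz]
        simp

/-- Moving the endpoint of a geodesic by one edge moves a point on it by at most one edge. -/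
theorem IsPrefix.exists_mul_simple {m y : W Γ} (h : IsPrefix m y) (a : V) :
    ∃ m', IsPrefix m' (y * (system Γ).simple a) ∧ ℓ (m⁻¹ * m') ≤ 1 := by
  by_cases hy : Desc y a
  · have hy' := (system Γ).isRightDescent_iff.1 hy
    by_cases hq : Desc (m⁻¹ * y) a
    · refine ⟨m, ?_, by simp⟩
      have hq' := (system Γ).isRightDescent_iff.1 hq
      unfold IsPrefix at *
      rw [← mul_assoc]
      omega
    · have h1 : ℓ (m * (m⁻¹ * y)) = ℓ m + ℓ (m⁻¹ * y) := by
        rw [mul_inv_cancel_left]; exact h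
      obtain ⟨h2, h3⟩ := isRightDescent_of_mul h1 (by simpa using hy) hq
      refine ⟨m * (system Γ).simple a, ?_, by simp⟩
      have h4 : (m * (system Γ).simple a)⁻¹ * (y * (system Γ).simple a) = m⁻¹ * y := by
        rw [mul_inv_rev, CoxeterSystem.inv_simple, mul_assoc, ← mul_assoc m⁻¹, ← h3,
          CoxeterSystem.simple_mul_simple_cancel_left]
      have h5 := (system Γ).isRightDescent_iff.1 h2
      unfold IsPrefix at *
      rw [h4]
      omega
  · refine ⟨m, h.trans ?_, by simp⟩
    simp [IsPrefix, (system Γ).not_isRightDescent_iff.1 hy]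

theorem IsPrefix.exists_near {m y : W Γ} (h : IsPrefix m y) (x : W Γ) :
    ∃ m', IsPrefix m' x ∧ ℓ (m⁻¹ * m') ≤ ℓ (y⁻¹ * x) := by
  obtain ⟨l, hl, e⟩ := (system Γ).exists_isReduced (y⁻¹ * x)
  obtain rfl : x = y * (system Γ).wordProd l := by simp [← e]
  rw [e, hl.eq]
  clear hl e
  induction l generalizing m y with
  | nil => exact ⟨m, by simpa using h, by simp⟩
  | cons a l ih =>
    obtain ⟨m₁, h1, h2⟩ := h.exists_mul_simple a
    obtain ⟨m₂, h3, h4⟩ := ih h1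
    refine ⟨m₂, ?_, ?_⟩
    · rwa [CoxeterSystem.wordProd_cons, ← mul_assoc]
    · have := length_inv_mul_le m m₁ m₂
      rw [List.length_cons]
      omega

/-- A point `z` closest to `1` in its `G`-orbit is at bounded distance from `1`, if every edge
pointing from `z` towards `1` has a point of the `r`-neighbourhood of `G` on the side of `z`. -/
theorem length_le_of_forall_not_isRightDescent [Fintype V] {G : Subgroup (W Γ)} {M r : ℕ}
    (hM : ∀ g ∈ G, ∀ m, IsPrefix m g → ∃ h ∈ G, ℓ (m⁻¹ * h) ≤ M) {z : W Γ}
    (hmin : ∀ g ∈ G, ℓ z ≤ ℓ (z⁻¹ * g))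
    (hz : ∀ s, ∃ h ∈ G, ∃ p, ℓ p ≤ r ∧ ¬ Desc ((h * p)⁻¹ * z) s) :
    ℓ z ≤ Fintype.card V * (M + r) := by
  classical
  have key : ∀ s, Desc z s → ∃ m : W Γ, IsPrefix m z ∧ ¬ Desc (m⁻¹ * z) s ∧ ℓ m ≤ M + r := by
    intro s hs
    obtain ⟨m, l, hl, hzm, hm, hd⟩ := exists_eq_mul_of_isRightDescent hs
    refine ⟨m, hm, ?_, ?_⟩
    · have := isRightDescent_mul_wordProd_iff hl 1
      rw [hzm, inv_mul_cancel_left]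
      rw [one_mul] at this
      rw [this]
      exact (system Γ).not_isRightDescent_one s
    · obtain ⟨h, hh, p, hp, hnd⟩ := hz s
      rw [hzm, ← mul_assoc, isRightDescent_mul_wordProd_iff hl] at hnd
      -- The geodesic from `1` to the point `h * p` can be chosen to pass through `m`.
      have h1 : IsPrefix m (h * p) := by
        have := length_mul_of_forall_isLeftDescent (u := (h * p)⁻¹ * m) (v := m⁻¹) (s := s)
          (fun t ht => hd t (by rwa [CoxeterSystem.isLeftDescent_inv_iff] at ht)) hnd
        rw [mul_inv_cancel_right, CoxeterSystem.length_inv, CoxeterSystem.length_inv,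
          length_inv_mul_comm] at this
        unfold IsPrefix
        omega
      obtain ⟨m', h2, h3⟩ := h1.exists_near h
      obtain ⟨g, hg, h4⟩ := hM h hh m' h2
      have h5 := hmin g hg
      have h6 := length_inv_mul_le z m g
      have h7 := length_inv_mul_le m m' g
      have h8 : ℓ ((h * p)⁻¹ * h) = ℓ p := by simp
      rw [length_inv_mul_comm z m] at h6
      unfold IsPrefix at hm
      omega
  choose! m hm hnd hlen using key
  obtain ⟨J, hJz, hmJ, hJ⟩ := exists_join_of_forall_isPrefix m
    (Finset.univ.filter fun s => Desc z s) fun s hs => hm s (Finset.mem_filter.1 hs).2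
  have hzJ : J⁻¹ * z = 1 := by
    by_contra hne
    obtain ⟨s, hs⟩ := (system Γ).exists_rightDescent_of_ne_one hne
    have hs' := (system Γ).isRightDescent_iff.1 hs
    have hds : ∀ a : W Γ, IsPrefix a J → Desc (a⁻¹ * z) s := by
      intro a ha
      have h1 := ha.length_inv_mul hJz
      have h2 := length_inv_mul_le a J (z * (system Γ).simple s)
      rw [← mul_assoc, ← mul_assoc] at h2
      rw [CoxeterSystem.IsRightDescent]
      omega
    have hzs : Desc z s := by simpa using hds 1 (.one J)
    exact hnd s hzs (hds _ (hmJ s (by simp [hzs])))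
  obtain rfl : z = J := by
    rw [inv_mul_eq_one] at hzJ
    exact hzJ.symm
  refine hJ.trans ((Finset.sum_le_card_nsmul _ _ (M + r) fun s hs => ?_).trans ?_)
  · exact hlen s (Finset.mem_filter.1 hs).2
  · rw [smul_eq_mul]
    exact Nat.mul_le_mul_right _ (Finset.card_le_univ _)

/-! ### Quasiconvexity in terms of the word length -/

theorem exists_walk_wordProd (x : W Γ) (l : List V) :
    ∃ p : (SimpleGraph.mulCayley (Set.range (system Γ).simple)).Walk x (x * (system Γ).wordProd l),
      p.length = l.length := by
  induction l generalizing x with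
  | nil => exact ⟨SimpleGraph.Walk.nil.copy rfl (by simp), by simp⟩
  | cons a l ih =>
    obtain ⟨p, hp⟩ := ih (x * (system Γ).simple a)
    have hadj : (SimpleGraph.mulCayley (Set.range (system Γ).simple)).Adj x
        (x * (system Γ).simple a) := by
      rw [SimpleGraph.mulCayley_adj']
      refine ⟨fun h => (system Γ).length_mul_simple_ne x a (by rw [← h]), _, ⟨a, rfl⟩, .inl rfl⟩
    exact ⟨(SimpleGraph.Walk.cons hadj p).copy rfl
      (by rw [CoxeterSystem.wordProd_cons, mul_assoc]), by simp [hp]⟩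

theorem exists_walk_length_eq (x y : W Γ) :
    ∃ p : (SimpleGraph.mulCayley (Set.range (system Γ).simple)).Walk x y,
      p.length = ℓ (x⁻¹ * y) := by
  obtain ⟨l, hl, e⟩ := (system Γ).exists_isReduced (x⁻¹ * y)
  obtain rfl : y = x * (system Γ).wordProd l := by simp [← e]
  obtain ⟨p, hp⟩ := exists_walk_wordProd x l
  exact ⟨p, by rw [hp, inv_mul_cancel_left, hl.eq]⟩

theorem length_le_walk_length {x y : W Γ}
    (p : (SimpleGraph.mulCayley (Set.range (system Γ).simple)).Walk x y) :
    ℓ (x⁻¹ * y) ≤ p.length := by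
  induction p with
  | nil => simp
  | @cons x y z h p ih =>
    have h1 : ℓ (x⁻¹ * y) ≤ 1 := by
      rw [SimpleGraph.mulCayley_adj'] at h
      obtain ⟨-, _, ⟨a, rfl⟩, rfl | rfl⟩ := h <;> simp
    have h2 := length_inv_mul_le x y z
    rw [SimpleGraph.Walk.length_cons]
    omega

theorem dist_mulCayley (x y : W Γ) :
    (SimpleGraph.mulCayley (Set.range (system Γ).simple)).dist x y = ℓ (x⁻¹ * y) := by
  obtain ⟨p, hp⟩ := exists_walk_length_eq x y
  refine le_antisymm (hp ▸ SimpleGraph.dist_le p) ?_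
  obtain ⟨q, hq⟩ := p.reachable.exists_walk_length_eq_dist
  exact hq ▸ length_le_walk_length q

theorem isQuasiconvexWith_iff {G : Subgroup (W Γ)} {M : ℕ} :
    IsQuasiconvexWith (Set.range (system Γ).simple) G M ↔
      ∀ g ∈ G, ∀ m, IsPrefix m g → ∃ h ∈ G, ℓ (m⁻¹ * h) ≤ M := by
  constructor
  · intro H g hg m hm
    obtain ⟨p, hp⟩ := exists_walk_length_eq 1 m
    obtain ⟨q, hq⟩ := exists_walk_length_eq m g
    obtain ⟨h, hh, hd⟩ := H 1 g (p.append q) G.one_mem hg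
      (by
        rw [SimpleGraph.Walk.length_append, hp, hq, dist_mulCayley]
        unfold IsPrefix at hm
        simp [hm])
      m ((SimpleGraph.Walk.mem_support_append_iff _ _).2 (.inl p.end_mem_support))
    exact ⟨h, hh, by rwa [dist_mulCayley] at hd⟩
  · intro H x y p hx hy hp z hz
    obtain ⟨q, r, rfl⟩ := SimpleGraph.Walk.mem_support_iff_exists_append.1 hz
    rw [dist_mulCayley, SimpleGraph.Walk.length_append] at hp
    have h1 := length_le_walk_length q
    have h2 := length_le_walk_length r
    have h3 : (x⁻¹ * z)⁻¹ * (x⁻¹ * y) = z⁻¹ * y := by simp [mul_assoc]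
    have h4 := length_le_add (x⁻¹ * z) (x⁻¹ * y)
    obtain ⟨h, hh, hd⟩ := H (x⁻¹ * y) (G.mul_mem (G.inv_mem hx) hy) (x⁻¹ * z) (by
      unfold IsPrefix
      rw [h3] at h4 ⊢
      omega)
    refine ⟨x * h, G.mul_mem hx hh, ?_⟩
    rw [dist_mulCayley]
    simpa [mul_assoc] using hd

theorem finite_setOf_length_le [Finite V] (n : ℕ) : {x : W Γ | ℓ x ≤ n}.Finite := by
  refine ((List.finite_length_le V n).image (system Γ).wordProd).subset fun x hx => ?_
  obtain ⟨l, hl, e⟩ := (system Γ).exists_isReduced x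
  refine ⟨l, ?_, e.symm⟩
  change l.length ≤ n
  rw [← hl.eq, ← e]
  exact hx

theorem fg_of_isQuasiconvexWith [Finite V] {G : Subgroup (W Γ)} {M : ℕ}
    (hM : ∀ g ∈ G, ∀ m, IsPrefix m g → ∃ h ∈ G, ℓ (m⁻¹ * h) ≤ M) : G.FG := by
  have hfin : ({x : W Γ | ℓ x ≤ 2 * M + 1} ∩ G).Finite :=
    (finite_setOf_length_le _).subset Set.inter_subset_left
  rw [Subgroup.fg_iff]
  refine ⟨_, ?_, hfin⟩
  refine le_antisymm ((Subgroup.closure_le G).2 Set.inter_subset_right) fun g hg => ?_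
  -- The elements of `G` that are close to a geodesic from `1` to `g` are generated one by one.
  have key : ∀ (n : ℕ) (m : W Γ), ℓ m = n → IsPrefix m g → ∀ h ∈ G, ℓ (m⁻¹ * h) ≤ M →
      h ∈ Subgroup.closure ({x : W Γ | ℓ x ≤ 2 * M + 1} ∩ G) := by
    intro n
    induction n with
    | zero =>
      intro m hm _ h hh hl
      rw [CoxeterSystem.length_eq_zero_iff] at hm
      subst hm
      refine Subgroup.subset_closure ⟨?_, hh⟩
      rw [inv_one, one_mul] at hl
      rw [Set.mem_ofPred_eq]
      omega
    | succ n ih =>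
      intro m hm hmg h hh hl
      have hm1 : m ≠ 1 := by rintro rfl; simp at hm
      obtain ⟨a, ha⟩ := (system Γ).exists_rightDescent_of_ne_one hm1
      have ha' := (system Γ).isRightDescent_iff.1 ha
      have hpre := (isPrefix_mul_simple ha).trans hmg
      obtain ⟨h', hh', hl'⟩ := hM g hg _ hpre
      have h1 := ih _ (by omega) hpre h' hh' hl'
      have h2 := length_inv_mul_le h' (m * (system Γ).simple a) h
      have h3 := length_inv_mul_le (m * (system Γ).simple a) m h
      have h4 : ℓ ((m * (system Γ).simple a)⁻¹ * m) = 1 := by simp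
      have h6 := length_inv_mul_comm h' (m * (system Γ).simple a)
      have h5 : h'⁻¹ * h ∈ Subgroup.closure ({x : W Γ | ℓ x ≤ 2 * M + 1} ∩ G) := by
        refine Subgroup.subset_closure ⟨?_, G.mul_mem (G.inv_mem hh') hh⟩
        rw [Set.mem_ofPred_eq]
        omega
      simpa using Subgroup.mul_mem _ h1 h5
  exact key _ g rfl (.refl g) g hg (by simp)

end Geodesics

namespace CubeComplex

variable {V : Type u} [DecidableEq V] {Γ : SimpleGraph V}

/-! ### Paths in cube complexes -/

section Paths

variable {C D : CubeComplex Γ}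

theorem flip_of_disjoint {A : Finset V} {c : C.Cell} (h : Disjoint A (C.labels c)) :
    C.flip A c = c := (C.flip_eq_self_iff A c).2 h

theorem flip_empty (c : C.Cell) : C.flip ∅ c = c := flip_of_disjoint (Finset.disjoint_empty_left _)

theorem flip_flip_self (A : Finset V) (c : C.Cell) : C.flip A (C.flip A c) = c := by
  rw [C.flip_flip, symmDiff_self]
  exact flip_empty c

theorem IsVertex.face_eq {v : C.Cell} (hv : C.IsVertex v) (τ : Finset V) : C.face τ v = v :=
  C.face_eq_self τ v (by rw [hv]; exact Finset.empty_subset _)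

theorem isVertex_source (c : C.Cell) : C.IsVertex (C.source c) := by
  simp [IsVertex, source, C.labels_face]

theorem isVertex_target (c : C.Cell) : C.IsVertex (C.target c) := isVertex_source _

theorem source_face (τ : Finset V) (c : C.Cell) : C.source (C.face τ c) = C.source c := by
  simp [source, C.face_face]

theorem IsEdge.flip {s : V} {d : C.Cell} (hd : C.IsEdge s d) (A : Finset V) :
    C.IsEdge s (C.flip A d) := by
  rw [IsEdge, C.labels_flip, hd]

theorem IsEdge.source_flip {s : V} {d : C.Cell} (hd : C.IsEdge s d) :
    C.source (C.flip {s} d) = C.target d := by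
  rw [target, hd]; rfl

theorem IsEdge.target_flip {s : V} {d : C.Cell} (hd : C.IsEdge s d) :
    C.target (C.flip {s} d) = C.source d := by
  rw [target, hd.flip {s}, flip_flip_self]; rfl

theorem path_nil_iff {u v : C.Cell} : C.Path u v [] ↔ C.IsVertex u ∧ v = u := by
  constructor
  · intro h
    cases h with
    | nil _ hv => exact ⟨hv, rfl⟩
  · rintro ⟨hu, rfl⟩
    exact .nil _ hu

theorem path_cons_iff {u v : C.Cell} {s : V} {w : List V} :
    C.Path u v (s :: w) ↔ ∃ d, C.IsEdge s d ∧ C.source d = u ∧ C.Path (C.target d) v w := by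
  constructor
  · intro h
    cases h with
    | cons _ d hd _ _ h => exact ⟨d, hd, rfl, h⟩
  · rintro ⟨d, hd, rfl, h⟩
    exact .cons s d hd v w h

theorem Path.isVertex_left {u v : C.Cell} {w : List V} (h : C.Path u v w) : C.IsVertex u := by
  cases h with
  | nil _ hv => exact hv
  | cons s d hd _ w h => exact isVertex_source d

theorem Path.isVertex_right {u v : C.Cell} {w : List V} (h : C.Path u v w) : C.IsVertex v := by
  induction h with
  | nil _ hv => exact hv
  | cons s d hd _ w h ih => exact ih

theorem path_append_iff {u v : C.Cell} {w w' : List V} :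
    C.Path u v (w ++ w') ↔ ∃ x, C.Path u x w ∧ C.Path x v w' := by
  induction w generalizing u with
  | nil =>
    constructor
    · intro h
      exact ⟨u, .nil u h.isVertex_left, h⟩
    · rintro ⟨x, hx, h⟩
      obtain ⟨-, rfl⟩ := path_nil_iff.1 hx
      exact h
  | cons s w ih =>
    simp only [List.cons_append, path_cons_iff, ih]
    constructor
    · rintro ⟨d, hd, hu, x, h, h'⟩
      exact ⟨x, ⟨d, hd, hu, h⟩, h'⟩
    · rintro ⟨x, ⟨d, hd, hu, h⟩, h'⟩
      exact ⟨d, hd, hu, x, h, h'⟩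

theorem Path.append {u v x : C.Cell} {w w' : List V} (h : C.Path u v w) (h' : C.Path v x w') :
    C.Path u x (w ++ w') := path_append_iff.2 ⟨v, h, h'⟩

theorem IsEdge.path {s : V} {d : C.Cell} (hd : C.IsEdge s d) :
    C.Path (C.source d) (C.target d) [s] :=
  .cons s d hd _ _ (.nil _ (isVertex_target d))

theorem Path.reverse {u v : C.Cell} {w : List V} (h : C.Path u v w) : C.Path v u w.reverse := by
  induction h with
  | nil v hv => exact .nil v hv
  | cons s d hd v w h ih =>
    rw [List.reverse_cons]
    refine ih.append ?_
    have := (hd.flip {s}).path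
    rwa [hd.source_flip, hd.target_flip] at this

theorem Hom.source_toFun (f : Hom C D) (c : C.Cell) :
    D.source (f.toFun c) = f.toFun (C.source c) := (f.toFun_face ∅ c).symm

theorem Hom.target_toFun (f : Hom C D) (c : C.Cell) :
    D.target (f.toFun c) = f.toFun (C.target c) := by
  rw [target, target, f.labels_toFun, f.toFun_face, f.toFun_flip]

theorem Path.map (f : Hom C D) {u v : C.Cell} {w : List V} (h : C.Path u v w) :
    D.Path (f.toFun u) (f.toFun v) w := by
  induction h with
  | nil v hv => exact .nil _ ((f.labels_toFun v).trans hv)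
  | cons s d hd v w h ih =>
    rw [← f.source_toFun]
    exact .cons s _ ((f.labels_toFun d).trans hd) _ _ (by rwa [f.target_toFun])

end Paths

section Folded

variable {C : CubeComplex Γ}

theorem IsFolded.target_eq (hC : C.IsFolded) {s : V} {d e : C.Cell} (hd : C.IsEdge s d)
    (he : C.IsEdge s e) (h : C.source d = C.source e) : C.target d = C.target e := by
  have hsame : C.SameCube d e := by
    by_contra hne
    exact hC.1 d e ⟨⟨s, hd, he⟩, h, hne⟩
  obtain ⟨A, rfl⟩ := hsame
  by_cases hA : s ∈ A
  · -- The two edges are the two orientations of a graph-loop.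
    have hflip : C.flip A d = C.flip {s} d := by
      rw [← flip_flip_self {s} (C.flip A d), C.flip_flip, ← C.flip_flip {s}]
      congr 1
      rw [C.flip_flip]
      refine flip_of_disjoint ?_
      rw [show C.labels d = {s} from hd, Finset.disjoint_singleton_right]
      simp [Finset.mem_symmDiff, hA]
    rw [hflip] at h ⊢
    rw [hd.target_flip, h, hd.source_flip]
  · rw [flip_of_disjoint]
    rw [show C.labels d = {s} from hd]
    exact Finset.disjoint_singleton_right.2 hA

theorem IsFolded.path_unique (hC : C.IsFolded) {w : List V} {u v v' : C.Cell} (h : C.Path u v w)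
    (h' : C.Path u v' w) : v = v' := by
  induction w generalizing u with
  | nil => exact (path_nil_iff.1 h).2.trans (path_nil_iff.1 h').2.symm
  | cons s w ih =>
    obtain ⟨d, hd, hu, h⟩ := path_cons_iff.1 h
    obtain ⟨e, he, hu', h'⟩ := path_cons_iff.1 h'
    rw [← hC.target_eq hd he (hu.trans hu'.symm)] at h'
    exact ih h h'

/-- Across the square provided by cube-fullness, two consecutive edges with adjacent labels can be
exchanged. -/
theorem IsFolded.path_swap (hC : C.IsFolded) (hC' : C.IsCubeFull) {s t : V} (hst : Γ.Adj s t)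
    {u v : C.Cell} (h : C.Path u v [s, t]) : C.Path u v [t, s] := by
  obtain ⟨d, hd, hu, h⟩ := path_cons_iff.1 h
  obtain ⟨e, he, hx, h⟩ := path_cons_iff.1 h
  obtain ⟨-, hv⟩ := path_nil_iff.1 h
  obtain ⟨c, hc, hcd⟩ := hC' (C.target d) {s, t} (fun a => if a = s then C.flip {s} d else e)
    (by simpa [SimpleGraph.isClique_iff, Set.pairwise_pair] using fun _ => hst)
    ⟨isVertex_target d, by
      intro a ha
      rw [Finset.mem_insert, Finset.mem_singleton] at ha
      rcases ha with rfl | rfl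
      · simpa using ⟨hd.flip _, hd.source_flip⟩
      · simpa [hst.ne'] using ⟨he, hx⟩⟩
  -- The square is turned so that its chosen corner is the one on the `s`-edge; by foldedness its
  -- `t`-edge at this corner ends where `e` does.
  obtain ⟨A, hA⟩ := hcd s (by simp)
  rw [if_pos rfl] at hA
  set c' := C.flip A c with hc'
  have hl : C.labels c' = {s, t} := by rw [hc', C.labels_flip, hc]
  have edge : ∀ (B : Finset V) (a : V), a ∈ ({s, t} : Finset V) →
      C.IsEdge a (C.face {a} (C.flip B c')) := by
    intro B a ha
    rw [IsEdge, C.labels_face, C.labels_flip, hl, Finset.inter_singleton_of_mem ha]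
  have tgt : ∀ (B : Finset V) (a : V), a ∈ ({s, t} : Finset V) →
      C.target (C.face {a} (C.flip B c')) = C.source (C.flip (symmDiff {a} B) c') := by
    intro B a ha
    rw [← (edge B a ha).source_flip, ← C.face_flip _ _ _ (Finset.Subset.refl _), source_face,
      C.flip_flip]
  have hs : s ∈ ({s, t} : Finset V) := by simp
  have ht : t ∈ ({s, t} : Finset V) := by simp
  have hsrc : C.source c' = C.target d := by
    rw [← source_face {s}, hA, hd.source_flip]
  have hv' : v = C.source (C.flip {t} c') := by
    have h1 := tgt ∅ t ht
    rw [flip_empty, ← Finset.bot_eq_empty, symmDiff_bot] at h1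
    rw [← h1, hv]
    have h2 := edge ∅ t ht
    rw [flip_empty] at h2
    exact hC.target_eq he h2 (by rw [hx, source_face, hsrc])
  have hu' : u = C.source (C.flip {s} c') := by
    have h1 := tgt ∅ s hs
    rw [flip_empty, ← Finset.bot_eq_empty, symmDiff_bot] at h1
    rw [← h1, hA, hd.target_flip, hu]
  have p1 := (edge {s} t ht).path
  have p2 := (edge {s, t} s hs).path
  rw [tgt _ _ ht, source_face] at p1
  rw [tgt _ _ hs, source_face] at p2
  have e1 : symmDiff {t} {s} = ({s, t} : Finset V) := by
    ext a
    simp only [Finset.mem_symmDiff, Finset.mem_singleton, Finset.mem_insert]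
    have := hst.ne
    grind
  have e2 : symmDiff {s} {s, t} = ({t} : Finset V) := by
    ext a
    simp only [Finset.mem_symmDiff, Finset.mem_singleton, Finset.mem_insert]
    have := hst.ne
    grind
  rw [e1] at p1
  rw [e2] at p2
  rw [hu', hv']
  exact p1.append p2

/-- In a folded and cube-full complex, if two vertices are joined by a path, then they are joined by
a path along any reduced word representing the same element.

The last letter `s` of the given path is compared with the reduced word `w'`. If `s` is a descent of
`w'` but not its last letter `t`, then `s` and `t` are adjacent, and a square exchanges them. If `s`
is not a descent of `w'`, then the path along `w' ++ [s]` given by induction ends with the last edge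
traversed backwards. -/
theorem IsFolded.path_of_isReduced (hC : C.IsFolded) (hC' : C.IsCubeFull) {u v : C.Cell}
    {w w' : List V} (h : C.Path u v w) (hw' : (system Γ).IsReduced w')
    (e : (system Γ).wordProd w' = (system Γ).wordProd w) : C.Path u v w' := by
  induction hn : w.length using Nat.strong_induction_on generalizing w w' v with
  | _ n ih =>
    rcases List.eq_nil_or_concat' w with rfl | ⟨w₀, s, rfl⟩
    · have h0 := hw'.eq
      rw [e, CoxeterSystem.wordProd_nil, CoxeterSystem.length_one, eq_comm,
        List.length_eq_zero_iff] at h0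
      rwa [h0]
    · rw [List.length_append, List.length_singleton] at hn
      obtain ⟨v₀, h₀, h₁⟩ := path_append_iff.1 h
      have hx₀ := wordProd_append_singleton_mul_simple (Γ := Γ) w₀ s
      rw [← e] at hx₀
      by_cases hs : (system Γ).IsRightDescent ((system Γ).wordProd w') s
      · have hs' := (system Γ).isRightDescent_iff.1 hs
        have hne : w' ≠ [] := by
          rintro rfl
          simp at hs'
        obtain ⟨w'', t, rfl⟩ := (List.eq_nil_or_concat' w').resolve_left hne
        have hlen := hw'.eq
        rw [List.length_append, List.length_singleton] at hlen
        have hw'' : (system Γ).IsReduced w'' := by simpa using hw'.take w''.length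
        by_cases hst : s = t
        · subst hst
          rw [wordProd_append_singleton_mul_simple] at hx₀
          exact (ih _ (by omega) h₀ hw'' hx₀ rfl).append h₁
        · have ht : (system Γ).IsRightDescent ((system Γ).wordProd (w'' ++ [t])) t := by
            rw [CoxeterSystem.IsRightDescent, wordProd_append_singleton_mul_simple, hlen, hw''.eq]
            omega
          have hadj := adj_of_isRightDescent hst hs ht
          have ht' := IsRightDescent.mul_simple hadj.symm ht
          rw [hx₀] at ht'
          have ht'' := (system Γ).isRightDescent_iff.1 ht'
          obtain ⟨r, hr, er⟩ :=
            (system Γ).exists_isReduced ((system Γ).wordProd w₀ * (system Γ).simple t)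
          have hr' : (system Γ).wordProd (r ++ [t]) = (system Γ).wordProd w₀ := by
            rw [wordProd_append_singleton, ← er, CoxeterSystem.simple_mul_simple_cancel_right]
          have hlr := hr.eq
          rw [← er] at hlr
          have hw₀ := (system Γ).length_wordProd_le w₀
          obtain ⟨p, hp₁, hp₂⟩ := path_append_iff.1 (ih _ (by omega) h₀ (w' := r ++ [t]) (by
            rw [CoxeterSystem.IsReduced, hr', List.length_append, List.length_singleton]
            omega) hr' rfl)
          obtain ⟨p', hp₃, hp₄⟩ := path_append_iff
            (u := p) (w := [s]) (w' := [t]) |>.1 (hC.path_swap hC' hadj.symm (hp₂.append h₁))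
          refine (ih (r ++ [s]).length ?_ (hp₁.append hp₃) hw'' ?_ rfl).append hp₄
          · rw [List.length_append, List.length_singleton]
            omega
          · rw [wordProd_append_singleton, ← er, ← hx₀, wordProd_append_singleton,
              mul_assoc _ ((system Γ).simple s), simple_comm hadj]
            simp only [← mul_assoc, CoxeterSystem.simple_mul_simple_cancel_right]
      · have hs' := (system Γ).not_isRightDescent_iff.1 hs
        rw [← wordProd_append_singleton] at hs' hx₀
        have := ih _ (by omega) h₀ (w' := w' ++ [s]) (by
          rw [CoxeterSystem.IsReduced, hs', hw'.eq, List.length_append, List.length_singleton])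
          hx₀ rfl
        obtain ⟨p, hp₁, hp₂⟩ := path_append_iff.1 this
        rwa [hC.path_unique h₁ hp₂.reverse]

end Folded

/-- A geodesic word representing an element of `G` is the label of a loop at `B`. From each vertex on
this loop, a path of bounded length leads back to `B`, which means that the corresponding point of
the Cayley graph is at bounded distance from `G`. -/
theorem IsCompletion.isQuasiconvexSubgroup {G : Subgroup (W Γ)} {Ω : CubeComplex Γ} {B : Ω.Cell}
    (h : IsCompletion G Ω B) (hfin : Ω.IsFinite) : IsQuasiconvexSubgroup Γ G := by
  have : Finite Ω.Cell := hfin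
  choose! w hw using h.connected
  obtain ⟨M, hM⟩ := Finite.bddAbove_range fun v => (w v).length
  refine ⟨M, isQuasiconvexWith_iff.2 fun g hg m hm => ?_⟩
  obtain ⟨l₁, hl₁, e₁⟩ := (system Γ).exists_isReduced m
  obtain ⟨l₂, hl₂, e₂⟩ := (system Γ).exists_isReduced (m⁻¹ * g)
  have e : (system Γ).wordProd (l₁ ++ l₂) = g := by
    rw [CoxeterSystem.wordProd_append, ← e₁, ← e₂, mul_inv_cancel_left]
  have hl : (system Γ).IsReduced (l₁ ++ l₂) := by
    rw [CoxeterSystem.IsReduced, e, List.length_append, ← hl₁.eq, ← hl₂.eq, ← e₁, ← e₂]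
    exact hm
  obtain ⟨v, hv, -⟩ := path_append_iff.1 (h.exists_loop _ hl (e ▸ hg))
  refine ⟨_, h.loop_mem _ (hv.append (hw v hv.isVertex_right).reverse), ?_⟩
  rw [CoxeterSystem.wordProd_append, ← e₁, inv_mul_cancel_left]
  refine ((system Γ).length_wordProd_le _).trans ?_
  rw [List.length_reverse]
  exact hM ⟨v, rfl⟩

/-! ### Developments of cube complexes -/

section Development

/-- A set of cosets which, with three of the corners of a square of the quotient of the Davis complex
by `G`, contains the fourth one. -/
def IsSquareClosed {G : Subgroup (W Γ)} (S : Set (W Γ ⧸ G)) : Prop :=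
  ∀ (q : W Γ ⧸ G) (s t : V), Γ.Adj s t → q ∈ S → (system Γ).simple s • q ∈ S →
    (system Γ).simple t • q ∈ S → (system Γ).simple s • (system Γ).simple t • q ∈ S

/-- A development of `C` into the set `S` of cosets: a map from the vertices of `C` to `S` that is
compatible with the edge labels. The coset `x⁻¹ G` stands for the orbit `G x` of the vertex `x` of
the Cayley graph; passing to inverses turns the right multiplication by a generator into the left
action of the generator. The map is extended to cornered cubes by their corners. -/
structure Development (C : CubeComplex Γ) {G : Subgroup (W Γ)} (S : Set (W Γ ⧸ G)) where
  toFun : C.Cell → W Γ ⧸ G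
  mem : ∀ c, toFun c ∈ S
  toFun_face : ∀ τ c, toFun (C.face τ c) = toFun c
  toFun_flip : ∀ s c, s ∈ C.labels c → toFun (C.flip {s} c) = (system Γ).simple s • toFun c

variable {C D : CubeComplex Γ} {G : Subgroup (W Γ)} {S : Set (W Γ ⧸ G)}

theorem Development.path (δ : Development C S) {u v : C.Cell} {w : List V} (h : C.Path u v w) :
    δ.toFun v = ((system Γ).wordProd w)⁻¹ • δ.toFun u := by
  induction h with
  | nil v hv => simp
  | cons s d hd v w h ih =>
    rw [ih, ← hd.source_flip, source, δ.toFun_face, δ.toFun_flip s d (by rw [hd]; simp), source,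
      δ.toFun_face, CoxeterSystem.wordProd_cons, mul_inv_rev, mul_smul, CoxeterSystem.inv_simple]

theorem Development.toFun_flip_congr (δ : Development C S) {c c' : C.Cell}
    (hl : C.labels c = C.labels c') (h : δ.toFun c = δ.toFun c') (A : Finset V) :
    δ.toFun (C.flip A c) = δ.toFun (C.flip A c') := by
  induction A using Finset.induction_on with
  | empty => rwa [flip_empty, flip_empty]
  | insert a A ha ih =>
    have e : insert a A = symmDiff {a} A := by
      ext x
      simp only [Finset.mem_insert, Finset.mem_symmDiff, Finset.mem_singleton]
      grind
    rw [e, ← C.flip_flip, ← C.flip_flip]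
    by_cases hal : a ∈ C.labels c
    · rw [δ.toFun_flip _ _ (by rwa [C.labels_flip]),
        δ.toFun_flip _ _ (by rwa [C.labels_flip, ← hl]), ih]
    · rw [flip_of_disjoint (A := {a}) (by rwa [C.labels_flip, Finset.disjoint_singleton_left]),
        flip_of_disjoint (A := {a}) (by rwa [C.labels_flip, ← hl, Finset.disjoint_singleton_left]),
        ih]

theorem Development.congr (δ : Development C S) {R : C.Cell → C.Cell → Prop}
    (hR : ∀ c c', R c c' → C.labels c = C.labels c' ∧ δ.toFun c = δ.toFun c') {c c' : C.Cell}
    (h : C.Congr R c c') : C.labels c = C.labels c' ∧ δ.toFun c = δ.toFun c' := by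
  induction h with
  | of c c' h => exact hR c c' h
  | refl c => exact ⟨rfl, rfl⟩
  | symm c c' _ ih => exact ⟨ih.1.symm, ih.2.symm⟩
  | trans c c' c'' _ _ ih ih' => exact ⟨ih.1.trans ih'.1, ih.2.trans ih'.2⟩
  | flip A c c' _ ih =>
    exact ⟨by rw [C.labels_flip, C.labels_flip, ih.1], δ.toFun_flip_congr ih.1 ih.2 A⟩
  | face τ c c' _ ih =>
    exact ⟨by rw [C.labels_face, C.labels_face, ih.1], by rw [δ.toFun_face, δ.toFun_face, ih.2]⟩

/-- A development descends along a quotient map if it respects the prescribed identifications. -/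
theorem Development.exists_of_isQuotientMap (δ : Development C S) {f : Hom C D}
    {R : C.Cell → C.Cell → Prop} (hf : f.IsQuotientMap R)
    (hR : ∀ c c', R c c' → C.labels c = C.labels c' ∧ δ.toFun c = δ.toFun c') :
    ∃ δ' : Development D S, ∀ c, δ'.toFun (f.toFun c) = δ.toFun c := by
  choose g hg using hf.1
  have hgf : ∀ c, δ.toFun (g (f.toFun c)) = δ.toFun c := fun c =>
    (δ.congr hR ((hf.2 _ _).1 (hg (f.toFun c)))).2
  refine ⟨⟨fun c => δ.toFun (g c), fun c => δ.mem _, fun τ c => ?_, fun s c hs => ?_⟩, hgf⟩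
  · have := hgf (C.face τ (g c))
    rwa [f.toFun_face, hg, δ.toFun_face] at this
  · have := hgf (C.flip {s} (g c))
    rwa [f.toFun_flip, hg, δ.toFun_flip _ _ (by rwa [← f.labels_toFun, hg])] at this

theorem congr_false_iff {c c' : C.Cell} : C.Congr (fun _ _ => False) c c' ↔ c = c' := by
  refine ⟨fun h => ?_, fun h => h ▸ .refl c⟩
  induction h with
  | of _ _ h => exact h.elim
  | refl => rfl
  | symm _ _ _ ih => exact ih.symm
  | trans _ _ _ _ _ ih ih' => exact ih.trans ih'
  | flip A _ _ _ ih => rw [ih]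
  | face τ _ _ _ ih => rw [ih]

theorem Hom.IsIso.isQuotientMap {f : Hom C D} (hf : f.IsIso) :
    f.IsQuotientMap fun _ _ => False :=
  ⟨hf.2, fun c c' => by rw [congr_false_iff]; exact hf.1.eq_iff⟩

open Classical in
variable (Γ) in
/-- The product of the generators in the clique `P` (and `1` if `P` is not a clique). -/
noncomputable def cliqueProd (P : Finset V) : W Γ :=
  if h : Γ.IsClique (P : Set V) then
    P.noncommProd (fun s => (system Γ).simple s)
      (show (P : Set V).Pairwise (Function.onFun Commute fun s => (system Γ).simple s) from
        fun _ ha _ hb hab => simple_comm (h ha hb hab))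
  else 1

theorem cliqueProd_empty : cliqueProd Γ ∅ = 1 := by
  simp [cliqueProd]

theorem cliqueProd_insert {s : V} {P : Finset V} (hs : s ∉ P)
    (h : Γ.IsClique (insert s P : Finset V)) :
    cliqueProd Γ (insert s P) = (system Γ).simple s * cliqueProd Γ P := by
  have h' : Γ.IsClique (P : Set V) := h.subset (by simp)
  rw [cliqueProd, cliqueProd, dif_pos h, dif_pos h']
  exact Finset.noncommProd_insert_of_notMem _ _ _ _ hs

theorem cliqueProd_symmDiff {s : V} {P : Finset V} (h : Γ.IsClique (insert s P : Finset V)) :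
    cliqueProd Γ (symmDiff P {s}) = (system Γ).simple s * cliqueProd Γ P := by
  by_cases hs : s ∈ P
  · have e : symmDiff P {s} = P.erase s := by
      ext x
      simp only [Finset.mem_erase, Finset.mem_symmDiff, Finset.mem_singleton]
      grind
    have h1 := cliqueProd_insert (Γ := Γ) (Finset.notMem_erase s P) (by
      rw [Finset.insert_erase hs]; rwa [Finset.insert_eq_of_mem hs] at h)
    rw [Finset.insert_erase hs] at h1
    rw [e, h1, CoxeterSystem.simple_mul_simple_cancel_left]
  · have e : symmDiff P {s} = insert s P := by
      ext x
      simp only [Finset.mem_insert, Finset.mem_symmDiff, Finset.mem_singleton]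
      grind
    rw [e, cliqueProd_insert hs h]

theorem IsSquareClosed.cliqueProd_smul_mem (hS : IsSquareClosed S) {q : W Γ ⧸ G} (hq : q ∈ S)
    {P : Finset V} (hP : Γ.IsClique (P : Set V)) (h : ∀ s ∈ P, (system Γ).simple s • q ∈ S) :
    cliqueProd Γ P • q ∈ S := by
  induction P using Finset.strongInduction with
  | H P ih =>
    rcases P.eq_empty_or_nonempty with rfl | ⟨s, hs⟩
    · rwa [cliqueProd_empty, one_smul]
    · obtain ⟨P, hsP, rfl⟩ : ∃ Q, s ∉ Q ∧ P = insert s Q :=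
        ⟨P.erase s, Finset.notMem_erase s P, (Finset.insert_erase hs).symm⟩
      rcases P.eq_empty_or_nonempty with rfl | ⟨t, ht⟩
      · rw [cliqueProd_insert hsP hP, cliqueProd_empty, mul_one]
        exact h s hs
      · obtain ⟨Q, htQ, rfl⟩ : ∃ Q, t ∉ Q ∧ P = insert t Q :=
          ⟨P.erase t, Finset.notMem_erase t P, (Finset.insert_erase ht).symm⟩
        have hst : s ≠ t := by rintro rfl; exact hsP ht
        have hsQ : s ∉ Q := fun hs => hsP (Finset.mem_insert_of_mem hs)
        have key : ∀ R, R ⊂ insert s (insert t Q) →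
            Γ.IsClique (R : Set V) ∧ cliqueProd Γ R • q ∈ S := by
          intro R hR
          have hRc : Γ.IsClique (R : Set V) := hP.subset (by exact_mod_cast hR.1)
          exact ⟨hRc, ih R hR hRc fun a ha => h a (hR.1 ha)⟩
        obtain ⟨-, h1⟩ := key Q ⟨by grind, by grind⟩
        obtain ⟨c2, h2⟩ := key (insert t Q) ⟨by grind, by grind⟩
        obtain ⟨c3, h3⟩ := key (insert s Q) ⟨by grind, by grind⟩
        rw [cliqueProd_insert htQ c2, mul_smul] at h2
        rw [cliqueProd_insert hsQ c3, mul_smul] at h3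
        rw [cliqueProd_insert hsP hP, cliqueProd_insert htQ c2, mul_smul, mul_smul]
        exact hS _ s t (hP (by simp) (by simp) hst) h1 h3 h2

theorem IsStar.smul_mem (δ : Development C S) {v : C.Cell} {σ : Finset V} {d : V → C.Cell}
    (h : C.IsStar v σ d) {s : V} (hs : s ∈ σ) : (system Γ).simple s • δ.toFun v ∈ S := by
  obtain ⟨h1, h2⟩ := h.2 s hs
  have := δ.mem (C.flip {s} (d s))
  rwa [δ.toFun_flip _ _ (by rw [h1]; simp), ← δ.toFun_face ∅,
    show C.face ∅ (d s) = v from h2] at this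

/-- The extension of a development over a cube that is to be attached at a star. -/
noncomputable def Development.sumStdCube (δ : Development C S) (hS : IsSquareClosed S) {v : C.Cell}
    {σ : Finset V} (hσ : Γ.IsClique (σ : Set V)) {d : V → C.Cell} (h : C.IsStar v σ d) :
    Development (C.sum (stdCube σ hσ)) S where
  toFun := Sum.elim δ.toFun fun c => cliqueProd Γ c.1.2 • δ.toFun v
  mem := by
    rintro (c | c)
    · exact δ.mem c
    · exact hS.cliqueProd_smul_mem (δ.mem v) (hσ.subset (by exact_mod_cast c.2.2))
        fun s hs => h.smul_mem δ (c.2.2 hs)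
  toFun_face := by
    rintro τ (c | c)
    · exact δ.toFun_face τ c
    · rfl
  toFun_flip := by
    rintro s (c | c) hs
    · exact δ.toFun_flip s c hs
    · have hs' : s ∈ c.1.1 := hs
      change cliqueProd Γ (symmDiff c.1.2 ({s} ∩ c.1.1)) • δ.toFun v =
        (system Γ).simple s • cliqueProd Γ c.1.2 • δ.toFun v
      rw [Finset.singleton_inter_of_mem hs', cliqueProd_symmDiff, mul_smul]
      refine hσ.subset ?_
      exact_mod_cast Finset.insert_subset (c.2.1 hs') c.2.2

/-- A development into a set that is closed under squares extends along each of the operations. -/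
theorem Development.exists_of_isOperation (δ : Development C S) (hS : IsSquareClosed S)
    {f : Hom C D}
    (hf : f.IsFold ∨ f.IsCubeIdentification ∨ f.IsCubeAttachment ∨ f.IsIso) :
    ∃ δ' : Development D S, ∀ c, δ'.toFun (f.toFun c) = δ.toFun c := by
  rcases hf with ⟨d, e, ⟨⟨s, hd, he⟩, hsrc, -⟩, hq⟩ | ⟨K, -, hK, hq⟩ |
    ⟨v, σ, hσ, d, q, hst, hq, hfq⟩ | hf
  · refine δ.exists_of_isQuotientMap hq ?_
    rintro c c' ⟨rfl, rfl⟩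
    refine ⟨by rw [hd, he], ?_⟩
    rw [← δ.toFun_face ∅, ← δ.toFun_face ∅ c']
    exact congrArg _ hsrc
  · refine δ.exists_of_isQuotientMap hq ?_
    rintro c c' ⟨hc, hc'⟩
    by_cases hcc : c = c'
    · rw [hcc]; exact ⟨rfl, rfl⟩
    · obtain ⟨hcard, ⟨hl, hb⟩, -⟩ := hK hc hc' hcc
      refine ⟨hl, ?_⟩
      have := hb ∅ ∅ (Finset.empty_ssubset.2 (Finset.card_pos.1 (by omega)))
      rw [flip_empty, flip_empty] at this
      rw [← δ.toFun_face ∅, this, δ.toFun_face]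
  · obtain ⟨δ', hδ'⟩ := (δ.sumStdCube hS hσ hst).exists_of_isQuotientMap hq (by
      rintro _ _ (_ | ⟨s, hs⟩)
      · refine ⟨hst.1, ?_⟩
        change δ.toFun v = cliqueProd Γ ∅ • δ.toFun v
        rw [cliqueProd_empty, one_smul]
      · refine ⟨(hst.2 s hs).1, ?_⟩
        change δ.toFun (d s) = cliqueProd Γ ∅ • δ.toFun v
        rw [cliqueProd_empty, one_smul, ← (hst.2 s hs).2, source, δ.toFun_face])
    exact ⟨δ', fun c => (congrArg δ'.toFun (hfq c)).trans (hδ' (Sum.inl c))⟩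
  · exact δ.exists_of_isQuotientMap hf.isQuotientMap fun _ _ h => h.elim

theorem OperationSequence.IsDirectLimit.compat_trans {X Ω : CubeComplex Γ} {Q : OperationSequence X}
    {φ : ∀ n, Hom (Q.obj n) Ω} (h : Q.IsDirectLimit Ω φ) (n k : ℕ) (c : (Q.obj n).Cell) :
    (φ (n + k)).toFun (Q.trans n k c) = (φ n).toFun c := by
  induction k with
  | zero => rfl
  | succ k ih => exact (h.compat _ _).trans ih

theorem OperationSequence.IsDirectLimit.exists_development {X Ω : CubeComplex Γ}
    {Q : OperationSequence X} {φ : ∀ n, Hom (Q.obj n) Ω} (h : Q.IsDirectLimit Ω φ)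
    (hS : IsSquareClosed S) (δ : Development X S) :
    ∃ δ' : Development Ω S, ∀ c, δ'.toFun ((φ 0).toFun (Q.init.toFun c)) = δ.toFun c := by
  obtain ⟨δ₀, h₀⟩ := δ.exists_of_isOperation hS (.inr (.inr (.inr Q.isIso_init)))
  let δs : ∀ n, Development (Q.obj n) S := fun n => Nat.rec δ₀
    (fun n δ => Classical.choose (δ.exists_of_isOperation hS (Q.isOperation n))) n
  have hδs : ∀ n c, (δs (n + 1)).toFun ((Q.map n).toFun c) = (δs n).toFun c := fun n =>
    Classical.choose_spec ((δs n).exists_of_isOperation hS (Q.isOperation n))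
  have htrans : ∀ n k c, (δs (n + k)).toFun (Q.trans n k c) = (δs n).toFun c := by
    intro n k c
    induction k with
    | zero => rfl
    | succ k ih => exact (hδs _ _).trans ih
  have hwd : ∀ n c m c', (φ n).toFun c = (φ m).toFun c' → (δs n).toFun c = (δs m).toFun c' := by
    have aux : ∀ n k c c', (φ n).toFun c = (φ (n + k)).toFun c' →
        (δs n).toFun c = (δs (n + k)).toFun c' := by
      intro n k c c' e
      rw [← h.compat_trans n k c, h.eq_iff] at e
      obtain ⟨j, hj⟩ := e
      rw [← htrans n k c, ← htrans (n + k) j, hj, htrans]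
    intro n c m c' e
    rcases le_total n m with hnm | hnm
    · obtain ⟨k, rfl⟩ := Nat.exists_eq_add_of_le hnm
      exact aux n k c c' e
    · obtain ⟨k, rfl⟩ := Nat.exists_eq_add_of_le hnm
      exact (aux m k c' c e.symm).symm
  choose n g hg using h.surj
  have key : ∀ m c, (δs _).toFun (g ((φ m).toFun c)) = (δs m).toFun c := fun m c =>
    hwd _ _ _ _ (hg _)
  refine ⟨⟨fun c => (δs (n c)).toFun (g c), fun c => (δs _).mem _, fun τ c => ?_,
    fun s c hs => ?_⟩, fun c => (key _ _).trans (h₀ c)⟩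
  · have := key _ ((Q.obj _).face τ (g c))
    rwa [Hom.toFun_face, hg, Development.toFun_face] at this
  · have := key _ ((Q.obj _).flip {s} (g c))
    rwa [Hom.toFun_flip, hg, Development.toFun_flip _ _ _ (by rwa [← (φ _).labels_toFun, hg])]
      at this

end Development

/-! ### Connectedness -/

section Connected

variable {C D : CubeComplex Γ}

/-- Every vertex can be reached from the base vertex `B` by a path. -/
def IsConnectedFrom (C : CubeComplex Γ) (B : C.Cell) : Prop :=
  ∀ v, C.IsVertex v → ∃ w, C.Path B v w

theorem IsConnectedFrom.map {B : C.Cell} (h : C.IsConnectedFrom B) {f : Hom C D}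
    (hf : Function.Surjective f.toFun) : D.IsConnectedFrom (f.toFun B) := by
  intro v hv
  obtain ⟨c, rfl⟩ := hf v
  obtain ⟨w, hw⟩ := h c ((f.labels_toFun c).symm.trans hv)
  exact ⟨w, hw.map f⟩

/-- The inclusion of the second summand into a disjoint union. -/
def sumInr (C D : CubeComplex Γ) : Hom D (C.sum D) := ⟨Sum.inr, fun _ => rfl, fun _ _ => rfl,
  fun _ _ => rfl⟩

theorem stdCube_isConnectedFrom {σ : Finset V} (hσ : Γ.IsClique (σ : Set V)) :
    (stdCube σ hσ).IsConnectedFrom (stdCube.base σ hσ) := by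
  have key : ∀ P, (hP : P ⊆ σ) → ∃ w, (stdCube σ hσ).Path (stdCube.base σ hσ)
      ⟨(∅, P), Finset.empty_subset σ, hP⟩ w := by
    intro P
    induction P using Finset.induction_on with
    | empty => exact fun _ => ⟨[], .nil _ rfl⟩
    | insert s P hs ih =>
      intro hP
      obtain ⟨w, hw⟩ := ih ((Finset.subset_insert s P).trans hP)
      let d : (stdCube σ hσ).Cell :=
        ⟨({s}, P), Finset.singleton_subset_iff.2 (hP (Finset.mem_insert_self s P)),
          (Finset.subset_insert s P).trans hP⟩
      have hd : (stdCube σ hσ).IsEdge s d := rfl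
      refine ⟨w ++ [s], hw.append ?_⟩
      have e₁ : (stdCube σ hσ).source d =
          ⟨(∅, P), Finset.empty_subset σ, (Finset.subset_insert s P).trans hP⟩ :=
        Subtype.ext (Prod.ext (Finset.inter_empty _) rfl)
      have e₂ : (stdCube σ hσ).target d = ⟨(∅, insert s P), Finset.empty_subset σ, hP⟩ := by
        refine Subtype.ext (Prod.ext (Finset.inter_empty _) ?_)
        change symmDiff P ({s} ∩ {s}) = insert s P
        ext x
        simp only [Finset.mem_insert, Finset.mem_symmDiff, Finset.mem_singleton, Finset.mem_inter]
        grind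
      rw [← e₁, ← e₂]
      exact hd.path
  rintro ⟨⟨τ, P⟩, hτ, hP⟩ hv
  obtain rfl : τ = ∅ := hv
  exact key P hP

theorem IsConnectedFrom.of_isOperation {B : C.Cell} (h : C.IsConnectedFrom B) {f : Hom C D}
    (hf : f.IsFold ∨ f.IsCubeIdentification ∨ f.IsCubeAttachment ∨ f.IsIso) :
    D.IsConnectedFrom (f.toFun B) := by
  rcases hf with ⟨d, e, -, hq⟩ | ⟨K, -, -, hq⟩ | ⟨v, σ, hσ, d, q, hst, hq, hfq⟩ | hf
  · exact h.map hq.1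
  · exact h.map hq.1
  · intro x hx
    obtain ⟨c | c, rfl⟩ := hq.1 x
    · have hc : C.IsVertex c := (q.labels_toFun (Sum.inl c)).symm.trans hx
      obtain ⟨w, hw⟩ := h c hc
      exact ⟨w, by rw [← hfq]; exact hw.map f⟩
    · have hc : (stdCube σ hσ).IsVertex c := (q.labels_toFun (Sum.inr c)).symm.trans hx
      obtain ⟨w, hw⟩ := h v hst.1
      obtain ⟨w', hw'⟩ := stdCube_isConnectedFrom hσ c hc
      refine ⟨w ++ w', (hw.map f).append ?_⟩
      have e : f.toFun v = q.toFun (Sum.inr (stdCube.base σ hσ)) := by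
        rw [hfq]
        exact (hq.2 _ _).2 (.of _ _ .vertex)
      rw [e]
      exact (hw'.map (sumInr C _)).map q
  · exact h.map hf.2

theorem OperationSequence.IsDirectLimit.isConnectedFrom {X Ω : CubeComplex Γ}
    {Q : OperationSequence X} {φ : ∀ n, Hom (Q.obj n) Ω} (h : Q.IsDirectLimit Ω φ) {B : X.Cell}
    (hB : X.IsConnectedFrom B) : Ω.IsConnectedFrom ((φ 0).toFun (Q.init.toFun B)) := by
  have key : ∀ n, ∃ b, (Q.obj n).IsConnectedFrom b ∧
      (φ n).toFun b = (φ 0).toFun (Q.init.toFun B) := by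
    intro n
    induction n with
    | zero => exact ⟨_, hB.map Q.isIso_init.2, rfl⟩
    | succ n ih =>
      obtain ⟨b, hb, e⟩ := ih
      exact ⟨_, hb.of_isOperation (Q.isOperation n), (h.compat n b).trans e⟩
  intro v hv
  obtain ⟨n, c, rfl⟩ := h.surj v
  obtain ⟨b, hb, e⟩ := key n
  obtain ⟨w, hw⟩ := hb c (((φ n).labels_toFun c).symm.trans hv)
  exact ⟨w, e ▸ hw.map (φ n)⟩

end Connected

end CubeComplex

namespace CubeComplex

/-! ### The local hull of a neighbourhood of a subgroup -/

section Hull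

variable {V : Type u} {Γ : SimpleGraph V}

local notation "ℓ" => CoxeterSystem.length (system _)

local notation "Desc" => CoxeterSystem.IsRightDescent (system _)

/-- The vertices of the Cayley graph, up to the action of `G`, that are not separated from the
`r`-neighbourhood of `G` by a wall next to them: each edge `z`, `z * a` has a point `g * p` of this
neighbourhood on the side of `z`. The element `g` of `G` is absorbed by the choice of the
representative `z`. -/
def localHull (G : Subgroup (W Γ)) (r : ℕ) : Set (W Γ ⧸ G) :=
  {q | ∀ a, ∃ p z : W Γ, ℓ p ≤ r ∧ ((z⁻¹ : W Γ) : W Γ ⧸ G) = q ∧ ¬ Desc (p⁻¹ * z) a}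

theorem mk_inv_mem_localHull {G : Subgroup (W Γ)} {r : ℕ} {p : W Γ} (hp : ℓ p ≤ r) :
    ((p⁻¹ : W Γ) : W Γ ⧸ G) ∈ localHull G r := fun a =>
  ⟨p, p, hp, rfl, by rw [inv_mul_cancel]; exact (system Γ).not_isRightDescent_one a⟩

theorem mk_inv_mul_simple (G : Subgroup (W Γ)) (z : W Γ) (s : V) :
    (((z * (system Γ).simple s)⁻¹ : W Γ) : W Γ ⧸ G) =
      (system Γ).simple s • ((z⁻¹ : W Γ) : W Γ ⧸ G) := by
  rw [mul_inv_rev, CoxeterSystem.inv_simple]; rfl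

/-- At the fourth corner of a square, an edge is parallel to an edge at a neighbouring corner if its
label is adjacent to that of one of the two sides of the square. Otherwise, the wall of the edge is
disjoint from the walls of the square. -/
theorem isSquareClosed_localHull (G : Subgroup (W Γ)) (r : ℕ) :
    IsSquareClosed (localHull G r) := by
  intro q s t hst _ hs ht a
  have hcomm : (system Γ).simple s • (system Γ).simple t • q =
      (system Γ).simple t • (system Γ).simple s • q := by
    rw [← mul_smul, simple_comm hst, mul_smul]
  by_cases has : Γ.Adj a s
  · obtain ⟨p, z, hp, hz, hd⟩ := ht a
    refine ⟨p, z * (system Γ).simple s, hp, by rw [mk_inv_mul_simple, hz], ?_⟩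
    rwa [← mul_assoc, isRightDescent_mul_simple_iff has]
  · by_cases hat : Γ.Adj a t
    · obtain ⟨p, z, hp, hz, hd⟩ := hs a
      refine ⟨p, z * (system Γ).simple t, hp, by rw [mk_inv_mul_simple, hz, hcomm], ?_⟩
      rwa [← mul_assoc, isRightDescent_mul_simple_iff hat]
    · obtain ⟨p, z, hp, hz, hd⟩ := hs t
      refine ⟨p, z * (system Γ).simple t, hp, by rw [mk_inv_mul_simple, hz, hcomm], fun hd' => ?_⟩
      rw [← mul_assoc] at hd'
      have hne : a ≠ t := by rintro rfl; exact has hst.symm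
      refine hat (adj_of_isRightDescent hne hd' ?_)
      rwa [CoxeterSystem.isRightDescent_iff_not_isRightDescent_mul,
        CoxeterSystem.simple_mul_simple_cancel_right]

/-- If `G` is quasiconvex, then the points of the local hull are at bounded distance from `G`. -/
theorem finite_localHull [Finite V] {G : Subgroup (W Γ)} {M : ℕ}
    (hM : ∀ g ∈ G, ∀ m, IsPrefix m g → ∃ h ∈ G, ℓ (m⁻¹ * h) ≤ M) (r : ℕ) :
    (localHull G r).Finite := by
  have := Fintype.ofFinite V
  refine ((finite_setOf_length_le (Γ := Γ) (Fintype.card V * (M + r))).image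
    fun z => ((z⁻¹ : W Γ) : W Γ ⧸ G)).subset fun q hq => ?_
  obtain ⟨z, hz, hmin⟩ : ∃ z : W Γ, ((z⁻¹ : W Γ) : W Γ ⧸ G) = q ∧
      ∀ z' : W Γ, ((z'⁻¹ : W Γ) : W Γ ⧸ G) = q → ℓ z ≤ ℓ z' := by
    obtain ⟨y, hy⟩ := QuotientGroup.mk_surjective q
    have hne : {z : W Γ | ((z⁻¹ : W Γ) : W Γ ⧸ G) = q}.Nonempty := ⟨y⁻¹, by
      change ((y⁻¹⁻¹ : W Γ) : W Γ ⧸ G) = q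
      rw [inv_inv]; exact hy⟩
    exact ⟨Function.argminOn ((system Γ).length) _ hne, Function.argminOn_mem _ _ hne,
      fun z' hz' => Function.argminOn_le (s := {z : W Γ | ((z⁻¹ : W Γ) : W Γ ⧸ G) = q}) _ hz'⟩
  refine ⟨z, ?_, hz⟩
  refine length_le_of_forall_not_isRightDescent hM (fun g hg => ?_) fun s => ?_
  · rw [length_inv_mul_comm]
    refine hmin _ ?_
    rw [← hz]
    exact QuotientGroup.eq.2 (by simpa using hg)
  · obtain ⟨p, z', hp, hz', hd⟩ := hq s
    rw [← hz, QuotientGroup.eq, inv_inv] at hz'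
    refine ⟨_, G.inv_mem hz', p, hp, ?_⟩
    have e : ((z' * z⁻¹)⁻¹ * p)⁻¹ * z = p⁻¹ * z' := by simp [mul_assoc]
    rwa [e]

end Hull

/-! ### The rose of a finite set of words -/

section Rose

variable {V : Type u} {T : Finset (List V)}

theorem rose_vertex_zero {w : List V} (hw : w ∈ T) : RoseCell.vertex T w hw 0 = .base := by
  simp [RoseCell.vertex]

theorem rose_vertex_length {w : List V} (hw : w ∈ T) :
    RoseCell.vertex T w hw w.length = .base := by
  simp [RoseCell.vertex]

theorem take_succ_eq_append_get (w : List V) (j : Fin w.length) :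
    w.take (j + 1) = w.take j ++ [w.get j] := by
  rw [List.take_succ_eq_append_getElem j.2]; rfl

variable {Γ : SimpleGraph V}

/-- The value of the development of the rose on its cells. -/
noncomputable def roseCoset (G : Subgroup (W Γ)) : RoseCell T → W Γ ⧸ G
  | .base => ((1 : W Γ) : W Γ ⧸ G)
  | .interior w _ j _ _ => ((((system Γ).wordProd (w.take j))⁻¹ : W Γ) : W Γ ⧸ G)
  | .edge w _ j fwd =>
    ((((system Γ).wordProd (w.take (if fwd then (j : ℕ) else (j : ℕ) + 1)))⁻¹ : W Γ) : W Γ ⧸ G)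

theorem roseCoset_vertex {G : Subgroup (W Γ)} (hT : ∀ w ∈ T, (system Γ).wordProd w ∈ G)
    {w : List V} (hw : w ∈ T) {j : ℕ} (hj : j ≤ w.length) :
    roseCoset G (RoseCell.vertex T w hw j) =
      ((((system Γ).wordProd (w.take j))⁻¹ : W Γ) : W Γ ⧸ G) := by
  rcases Nat.eq_zero_or_pos j with rfl | h0
  · rw [rose_vertex_zero, List.take_zero, CoxeterSystem.wordProd_nil, inv_one]; rfl
  · rcases hj.eq_or_lt with rfl | h1
    · rw [rose_vertex_length, List.take_length]
      refine QuotientGroup.eq.2 ?_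
      rw [inv_one, one_mul]
      exact G.inv_mem (hT w hw)
    · rw [RoseCell.vertex, dif_pos ⟨h0, h1⟩]; rfl

variable [DecidableEq V]

theorem rose_path_take {w : List V} (hw : w ∈ T) (j : ℕ) (hj : j ≤ w.length) :
    (rose Γ T).Path .base (RoseCell.vertex T w hw j) (w.take j) := by
  induction j with
  | zero =>
    rw [rose_vertex_zero, List.take_zero]
    exact .nil (C := rose Γ T) _ rfl
  | succ j ih =>
    let i : Fin w.length := ⟨j, hj⟩
    have hd : (rose Γ T).IsEdge (w.get i) (.edge w hw i true) := rfl
    have e₁ : (rose Γ T).source (.edge w hw i true) = RoseCell.vertex T w hw j := rfl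
    have e₂ : (rose Γ T).target (.edge w hw i true) = RoseCell.vertex T w hw (j + 1) := by
      refine hd.source_flip.symm.trans ?_
      change RoseCell.face ∅ (RoseCell.flip {w.get i} (.edge w hw i true)) = _
      rw [RoseCell.flip, if_pos (Finset.mem_singleton_self _)]
      rfl
    have := hd.path
    rw [e₁, e₂] at this
    rw [take_succ_eq_append_get w i]
    exact (ih (by omega)).append this

theorem rose_path_loop {w : List V} (hw : w ∈ T) : (rose Γ T).Path .base .base w := by
  simpa [rose_vertex_length] using rose_path_take (Γ := Γ) hw w.length le_rfl

theorem rose_isConnectedFrom : (rose Γ T).IsConnectedFrom .base := by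
  rintro (_ | ⟨w, hw, j, h0, h1⟩ | ⟨w, hw, j, fwd⟩) hv
  · exact ⟨[], .nil (C := rose Γ T) _ rfl⟩
  · have := rose_path_take (Γ := Γ) hw j h1.le
    rw [RoseCell.vertex, dif_pos ⟨h0, h1⟩] at this
    exact ⟨_, this⟩
  · exact absurd hv (Finset.singleton_ne_empty _)

theorem rose_exists_loop {g : W Γ}
    (hg : g ∈ Subgroup.closure ((system Γ).wordProd '' (T : Set (List V)))) :
    ∃ w, (system Γ).wordProd w = g ∧ (rose Γ T).Path .base .base w := by
  induction hg using Subgroup.closure_induction with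
  | mem x hx =>
    obtain ⟨w, hw, rfl⟩ := hx
    exact ⟨w, rfl, rose_path_loop hw⟩
  | one => exact ⟨[], by simp, .nil (C := rose Γ T) _ rfl⟩
  | mul x y _ _ hx hy =>
    obtain ⟨w, rfl, h⟩ := hx
    obtain ⟨w', rfl, h'⟩ := hy
    exact ⟨w ++ w', CoxeterSystem.wordProd_append _ _ _, h.append h'⟩
  | inv x _ hx =>
    obtain ⟨w, rfl, h⟩ := hx
    exact ⟨w.reverse, CoxeterSystem.wordProd_reverse _ _, h.reverse⟩

/-- The rose of words representing elements of `G` has a development: a vertex goes to the coset of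
the word read on the way from the base vertex. -/
noncomputable def roseDevelopment {G : Subgroup (W Γ)} {S : Set (W Γ ⧸ G)}
    (hT : ∀ w ∈ T, (system Γ).wordProd w ∈ G) (h1 : ((1 : W Γ) : W Γ ⧸ G) ∈ S)
    (hS : ∀ w ∈ T, ∀ j, ((((system Γ).wordProd (w.take j))⁻¹ : W Γ) : W Γ ⧸ G) ∈ S) :
    Development (rose Γ T) S where
  toFun := roseCoset G
  mem := by
    rintro (_ | ⟨w, hw, j, _, _⟩ | ⟨w, hw, j, fwd⟩)
    · exact h1
    · exact hS w hw j
    · exact hS w hw _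
  toFun_face := by
    rintro τ (_ | ⟨w, hw, j, _, _⟩ | ⟨w, hw, j, fwd⟩)
    · rfl
    · rfl
    · change roseCoset G (RoseCell.face τ (.edge w hw j fwd)) = roseCoset G (.edge w hw j fwd)
      rw [RoseCell.face]
      split_ifs with h h'
      · rfl
      · subst h'
        exact roseCoset_vertex hT hw j.2.le
      · rw [roseCoset_vertex hT hw j.2, roseCoset, if_neg h']
  toFun_flip := by
    rintro s (_ | ⟨w, hw, j, _, _⟩ | ⟨w, hw, j, fwd⟩) hs
    · exact absurd hs (Finset.notMem_empty s)
    · exact absurd hs (Finset.notMem_empty s)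
    · obtain rfl : s = w.get j := Finset.mem_singleton.1 hs
      change roseCoset G (RoseCell.flip {w.get j} (.edge w hw j fwd)) =
        (system Γ).simple (w.get j) • roseCoset G (.edge w hw j fwd)
      rw [RoseCell.flip, if_pos (Finset.mem_singleton_self _)]
      have h := take_succ_eq_append_get w j
      cases fwd
      · change ((((system Γ).wordProd (w.take j))⁻¹ : W Γ) : W Γ ⧸ G) =
          (((system Γ).simple (w.get j) * ((system Γ).wordProd (w.take (j + 1)))⁻¹ : W Γ) : W Γ ⧸ G)
        rw [h, wordProd_append_singleton, mul_inv_rev, CoxeterSystem.inv_simple,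
          CoxeterSystem.simple_mul_simple_cancel_left]
      · change ((((system Γ).wordProd (w.take (j + 1)))⁻¹ : W Γ) : W Γ ⧸ G) =
          (((system Γ).simple (w.get j) * ((system Γ).wordProd (w.take j))⁻¹ : W Γ) : W Γ ⧸ G)
        rw [h, wordProd_append_singleton, mul_inv_rev, CoxeterSystem.inv_simple]

end Rose

variable {V : Type u} [DecidableEq V] {Γ : SimpleGraph V}

/-! ### Finiteness of folded complexes -/

theorem IsFolded.isFinite_of_finite_setOf_isVertex [Finite V] {C : CubeComplex Γ}
    (hC : C.IsFolded) (hfin : {v | C.IsVertex v}.Finite) : C.IsFinite := by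
  have := Fintype.ofFinite V
  -- Cubes of dimension `n + 1` are determined by their boundaries, up to moving the corner.
  have key : ∀ n, {c | (C.labels c).card ≤ n}.Finite := by
    intro n
    induction n with
    | zero =>
      refine hfin.subset fun c hc => ?_
      exact Finset.card_eq_zero.1 (Nat.le_zero.1 hc)
    | succ n ih =>
      let F : C.Cell → Finset V × (Finset V → Finset V → Option C.Cell) := fun c =>
        (C.labels c, fun A τ => if τ ⊂ C.labels c then some (C.face τ (C.flip A c)) else none)
      let S : Set (Finset V × (Finset V → Finset V → Option C.Cell)) :=
        {b | b.1.card = n + 1} ∩ Set.univ ×ˢ Set.univ.pi fun _ => Set.univ.pi fun _ =>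
          insert none (some '' {c | (C.labels c).card ≤ n})
      have hS : S.Finite := (Set.finite_univ.prod (Set.Finite.pi' fun _ => Set.Finite.pi' fun _ =>
        (ih.image some).insert none) |>.subset (by
          rintro b ⟨-, -, hb⟩
          exact ⟨trivial, fun A τ => hb A trivial τ trivial⟩))
      have hpre : (F ⁻¹' S).Finite := by
        refine Set.Finite.preimage' hS fun b hb => ?_
        rcases (F ⁻¹' {b}).eq_empty_or_nonempty with h | ⟨c, rfl⟩
        · rw [h]; exact Set.finite_empty
        · refine (Set.finite_range fun A => C.flip A c).subset fun c' hc' => ?_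
          have hcard : (C.labels c).card = n + 1 := hb.1
          have hl : C.labels c = C.labels c' := (congrArg Prod.fst hc').symm
          have hbd : ∀ A τ, τ ⊂ C.labels c → C.face τ (C.flip A c) = C.face τ (C.flip A c') := by
            intro A τ hτ
            have := congrFun (congrFun (congrArg Prod.snd hc') A) τ
            simp only [F] at this
            rw [if_pos hτ, if_pos (hl ▸ hτ)] at this
            exact (Option.some.inj this).symm
          by_contra hne
          have hsame : ¬ C.SameCube c c' := by
            rintro ⟨A, rfl⟩
            exact hne ⟨A, rfl⟩
          rcases Nat.eq_zero_or_pos n with rfl | hn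
          · obtain ⟨s, hs⟩ := Finset.card_eq_one.1 hcard
            refine hC.1 c c' ⟨⟨s, hs, hl.symm.trans hs⟩, ?_, hsame⟩
            have := hbd ∅ ∅ (by rw [hs]; simp)
            rwa [flip_empty, flip_empty] at this
          · exact hC.2 c c' ⟨by omega, ⟨hl, hbd⟩, hsame⟩
      refine (ih.union hpre).subset fun c hc => ?_
      rcases Nat.lt_or_ge n (C.labels c).card with h | h
      · right
        have hcard : (C.labels c).card = n + 1 := le_antisymm hc h
        refine ⟨hcard, trivial, fun A _ τ _ => ?_⟩
        simp only [F]
        split_ifs with hτ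
        · right
          refine ⟨_, ?_, rfl⟩
          have h1 := Finset.card_lt_card hτ
          have h2 : (C.labels (C.face τ (C.flip A c))).card ≤ τ.card := by
            rw [C.labels_face]
            exact Finset.card_le_card Finset.inter_subset_right
          change _ ≤ n
          omega
        · exact .inl rfl
      · exact .inl h
  have huniv := key (Fintype.card V)
  rw [Set.eq_univ_of_forall (s := {c | (C.labels c).card ≤ Fintype.card V})
    fun c => Finset.card_le_univ _] at huniv
  exact Set.finite_univ_iff.1 huniv

/-! ### Standard completions -/

section Standard

variable {G : Subgroup (W Γ)} {Ω : CubeComplex Γ}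

/-- A development of a completion separates the vertices. -/
theorem IsCompletion.development_injOn {B : Ω.Cell} (h : IsCompletion G Ω B) {S : Set (W Γ ⧸ G)}
    (δ : Development Ω S) (hB : δ.toFun B = ((1 : W Γ) : W Γ ⧸ G)) :
    Set.InjOn δ.toFun {v | Ω.IsVertex v} := by
  intro v hv v' hv' e
  obtain ⟨w, hw⟩ := h.connected v hv
  obtain ⟨w', hw'⟩ := h.connected v' hv'
  have e' : ((((system Γ).wordProd w')⁻¹ * 1 : W Γ) : W Γ ⧸ G) =
      ((((system Γ).wordProd w)⁻¹ * 1 : W Γ) : W Γ ⧸ G) := by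
    rw [δ.path hw, δ.path hw', hB] at e
    exact e.symm
  rw [QuotientGroup.eq, mul_one, mul_one, inv_inv] at e'
  obtain ⟨l, hl, el⟩ :=
    (system Γ).exists_isReduced ((system Γ).wordProd w' * ((system Γ).wordProd w)⁻¹)
  obtain ⟨r, hr, er⟩ := (system Γ).exists_isReduced ((system Γ).wordProd w')
  have h1 := h.exists_loop l hl (el ▸ e')
  have h2 : (system Γ).wordProd r = (system Γ).wordProd (l ++ w) := by
    rw [CoxeterSystem.wordProd_append, ← el, inv_mul_cancel_right, er]
  exact h.isFolded.path_unique
    (h.isFolded.path_of_isReduced h.isCubeFull (h1.append hw) hr h2)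
    (h.isFolded.path_of_isReduced h.isCubeFull hw' hr er.symm)

/-- A standard completion of `G` is a completion of `G`, and the development of the rose extends to it.
The development shows that loops at the base vertex represent elements of `G`. -/
theorem IsStandardCompletion.exists_isCompletion (h : IsStandardCompletion G Ω) :
    ∃ (B : Ω.Cell) (r : ℕ) (δ : Development Ω (localHull G r)), IsCompletion G Ω B ∧
      δ.toFun B = ((1 : W Γ) : W Γ ⧸ G) := by
  obtain ⟨T, hT, ⟨Q, φ, hlim⟩, hfold, hfull⟩ := h
  have hTG : ∀ w ∈ T, (system Γ).wordProd w ∈ G := fun w hw =>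
    hT ▸ Subgroup.subset_closure ⟨w, hw, rfl⟩
  let r := T.sup List.length
  have h1 : ((1 : W Γ) : W Γ ⧸ G) ∈ localHull G r := by
    have := mk_inv_mem_localHull (Γ := Γ) (G := G) (r := r) (p := 1) (by simp)
    rwa [inv_one] at this
  have hS : ∀ w ∈ T, ∀ j,
      ((((system Γ).wordProd (w.take j))⁻¹ : W Γ) : W Γ ⧸ G) ∈ localHull G r := fun w hw j =>
    mk_inv_mem_localHull (((system Γ).length_wordProd_le _).trans
      ((List.length_take_le' j w).trans (Finset.le_sup (f := List.length) hw)))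
  obtain ⟨δ, hδ⟩ := hlim.exists_development (isSquareClosed_localHull G r)
    (roseDevelopment hTG h1 hS)
  have hB : δ.toFun ((φ 0).toFun (Q.init.toFun .base)) = ((1 : W Γ) : W Γ ⧸ G) := hδ .base
  refine ⟨(φ 0).toFun (Q.init.toFun .base), r, δ, ⟨?_, ?_, hfold, hfull, ?_, ?_⟩, hB⟩
  · exact ((φ 0).labels_toFun _).trans (Q.init.labels_toFun _)
  · exact hlim.isConnectedFrom rose_isConnectedFrom
  · intro w hw
    have := δ.path hw
    rw [hB] at this
    have h2 := QuotientGroup.eq.1 this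
    simpa using h2
  · intro w hw hwG
    rw [← hT] at hwG
    obtain ⟨w', e, hw'⟩ := rose_exists_loop hwG
    exact hfold.path_of_isReduced hfull ((hw'.map Q.init).map (φ 0)) hw e.symm

/-- The vertices of a standard completion are embedded by its development in the local hull, which is
finite if `G` is quasiconvex. -/
theorem IsStandardCompletion.isFinite [Finite V] (h : IsStandardCompletion G Ω)
    (hG : IsQuasiconvexSubgroup Γ G) : Ω.IsFinite := by
  obtain ⟨B, r, δ, hB, h1⟩ := h.exists_isCompletion
  obtain ⟨M, hM⟩ := hG
  refine hB.isFolded.isFinite_of_finite_setOf_isVertex ?_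
  refine Set.Finite.of_finite_image ?_ (hB.development_injOn δ h1)
  refine (finite_localHull (isQuasiconvexWith_iff.1 hM) r).subset ?_
  rintro _ ⟨v, -, rfl⟩
  exact δ.mem v

end Standard

/-! ### Quotients of cube complexes -/

section Quotient

variable {C : CubeComplex Γ} {R : C.Cell → C.Cell → Prop}

theorem Congr.labels_eq (hl : ∀ c c', R c c' → C.labels c = C.labels c') {c c' : C.Cell}
    (h : C.Congr R c c') : C.labels c = C.labels c' := by
  induction h with
  | of c c' h => exact hl c c' h
  | refl => rfl
  | symm _ _ _ ih => exact ih.symm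
  | trans _ _ _ _ _ ih ih' => exact ih.trans ih'
  | flip A _ _ _ ih => rw [C.labels_flip, C.labels_flip, ih]
  | face τ _ _ _ ih => rw [C.labels_face, C.labels_face, ih]

variable (C R) in
/-- The congruence generated by `R`, as a setoid. -/
def congrSetoid : Setoid C.Cell where
  r := C.Congr R
  iseqv := ⟨.refl, fun h => .symm _ _ h, fun h h' => .trans _ _ _ h h'⟩

variable (C R) in
/-- The quotient of a cube complex by the congruence generated by `R`, provided that the congruence
preserves labels and does not identify different corners of one cube. -/
def quotient (hl : ∀ c c', R c c' → C.labels c = C.labels c')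
    (hR : ∀ A c, C.Congr R (C.flip A c) c → Disjoint A (C.labels c)) : CubeComplex Γ where
  Cell := Quotient (congrSetoid C R)
  labels := Quotient.lift C.labels fun _ _ h => Congr.labels_eq hl h
  flip A := Quotient.map (C.flip A) fun _ _ h => .flip A _ _ h
  face τ := Quotient.map (C.face τ) fun _ _ h => .face τ _ _ h
  isClique_labels := Quotient.ind C.isClique_labels
  labels_flip A := Quotient.ind (C.labels_flip A)
  flip_flip A B := Quotient.ind fun c => congrArg (Quotient.mk _) (C.flip_flip A B c)
  flip_eq_self_iff A := Quotient.ind fun c => ⟨fun h => hR A c (Quotient.exact h),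
    fun h => congrArg (Quotient.mk _) ((C.flip_eq_self_iff A c).2 h)⟩
  labels_face τ := Quotient.ind (C.labels_face τ)
  face_eq_self τ := Quotient.ind fun c h => congrArg (Quotient.mk _) (C.face_eq_self τ c h)
  face_face τ τ' := Quotient.ind fun c => congrArg (Quotient.mk _) (C.face_face τ τ' c)
  face_flip A τ := Quotient.ind fun c h => congrArg (Quotient.mk _) (C.face_flip A τ c h)

theorem exists_isQuotientMap (hl : ∀ c c', R c c' → C.labels c = C.labels c')
    (hR : ∀ A c, C.Congr R (C.flip A c) c → Disjoint A (C.labels c)) :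
    ∃ (D : CubeComplex Γ) (f : Hom C D), f.IsQuotientMap R :=
  ⟨C.quotient R hl hR, ⟨Quotient.mk _, fun _ => rfl, fun _ _ => rfl, fun _ _ => rfl⟩,
    Quotient.mk_surjective, fun _ _ => Quotient.eq⟩

/-- A criterion for the existence of a quotient: there is a map `ρ`, choosing a representative of
each class of cells other than vertices, that is compatible with labels, corners and faces. -/
theorem exists_isQuotientMap_of_retraction (ρ : C.Cell → C.Cell)
    (hlab : ∀ c, C.labels (ρ c) = C.labels c) (hflip : ∀ A c, ρ (C.flip A c) = C.flip A (ρ c))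
    (hface : ∀ τ c, C.IsVertex (C.face τ c) ∨ ρ (C.face τ c) = ρ (C.face τ (ρ c)))
    (hR : ∀ c c', R c c' → C.labels c = C.labels c' ∧ (C.IsVertex c ∨ ρ c = ρ c')) :
    ∃ (D : CubeComplex Γ) (f : Hom C D), f.IsQuotientMap R := by
  have key : ∀ c c', C.Congr R c c' → C.labels c = C.labels c' ∧ (C.IsVertex c ∨ ρ c = ρ c') := by
    intro c c' h
    induction h with
    | of c c' h => exact hR c c' h
    | refl => exact ⟨rfl, .inr rfl⟩
    | symm _ _ _ ih => exact ⟨ih.1.symm, ih.2.imp (fun h => ih.1.symm.trans h) Eq.symm⟩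
    | trans _ _ _ _ _ ih ih' =>
      refine ⟨ih.1.trans ih'.1, ?_⟩
      rcases ih.2 with h | h
      · exact .inl h
      · exact ih'.2.imp (fun h' => ih.1.trans h') h.trans
    | flip A _ _ _ ih =>
      refine ⟨by rw [C.labels_flip, C.labels_flip, ih.1], ih.2.imp ?_ fun h => ?_⟩
      · exact fun h => (C.labels_flip _ _).trans h
      · rw [hflip, hflip, h]
    | face τ c c' _ ih =>
      have e : C.labels (C.face τ c) = C.labels (C.face τ c') := by
        rw [C.labels_face, C.labels_face, ih.1]
      refine ⟨e, ?_⟩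
      rcases ih.2 with h | h
      · left
        rw [h.face_eq]
        exact h
      · rcases hface τ c with h1 | h1
        · exact .inl h1
        · rcases hface τ c' with h2 | h2
          · exact .inl (e.trans h2)
          · right
            rw [h1, h2, h]
  refine exists_isQuotientMap (fun c c' h => (hR c c' h).1) fun A c h => ?_
  rcases (key _ _ h).2 with h1 | h1
  · have h2 : C.labels c = ∅ := (C.labels_flip A c).symm.trans h1
    rw [h2]
    exact Finset.disjoint_empty_right _
  · rw [hflip, C.flip_eq_self_iff, hlab] at h1
    exact h1

theorem flip_eq_flip_iff {A B : Finset V} {c : C.Cell} :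
    C.flip A c = C.flip B c ↔ Disjoint (symmDiff B A) (C.labels c) := by
  rw [← C.flip_eq_self_iff, ← C.flip_flip]
  constructor
  · intro h
    rw [h, flip_flip_self]
  · intro h
    rw [← h, flip_flip_self, h]

theorem SameCube.symm {c c' : C.Cell} (h : C.SameCube c c') : C.SameCube c' c := by
  obtain ⟨A, rfl⟩ := h
  exact ⟨A, (flip_flip_self A c).symm⟩

theorem face_inter_labels (τ : Finset V) (c : C.Cell) : C.face (C.labels c ∩ τ) c = C.face τ c := by
  rw [Finset.inter_comm, ← C.face_face, C.face_eq_self _ c (Finset.Subset.refl _)]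

/-- Two distinct cubes can be identified if their proper faces other than vertices coincide. -/
theorem exists_isQuotientMap_of_pair {a b : C.Cell} (hl : C.labels a = C.labels b)
    (hne : ¬ C.SameCube a b)
    (hbd : ∀ A τ, τ ⊂ C.labels a → τ = ∅ ∨ C.face τ (C.flip A a) = C.face τ (C.flip A b))
    (hpos : C.labels a ≠ ∅)
    (hR : ∀ c c', R c c' → (c = a ∨ c = b) ∧ (c' = a ∨ c' = b)) :
    ∃ (D : CubeComplex Γ) (f : Hom C D), f.IsQuotientMap R := by
  classical
  -- The representative of a corner of the cube of `b` is the same corner of the cube of `a`.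
  let ρ : C.Cell → C.Cell := fun c => if h : C.SameCube b c then C.flip h.choose a else c
  have hρb : ∀ A, ρ (C.flip A b) = C.flip A a := by
    intro A
    have h : C.SameCube b (C.flip A b) := ⟨A, rfl⟩
    simp only [ρ, dif_pos h]
    have := h.choose_spec
    rw [flip_eq_flip_iff] at this
    rw [eq_comm, flip_eq_flip_iff, hl]
    exact this
  have hρ : ∀ c, ¬ C.SameCube b c → ρ c = c := fun c h => by simp only [ρ, dif_neg h]
  have hρa : ∀ A, ρ (C.flip A a) = C.flip A a := by
    intro A
    refine hρ _ ?_
    rintro ⟨B, hB⟩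
    refine hne ⟨symmDiff B A, ?_⟩
    rw [← C.flip_flip, hB, flip_flip_self]
  refine exists_isQuotientMap_of_retraction ρ ?_ ?_ ?_ ?_
  · intro c
    by_cases h : C.SameCube b c
    · obtain ⟨A, rfl⟩ := h
      rw [hρb, C.labels_flip, C.labels_flip, hl]
    · rw [hρ c h]
  · intro A c
    by_cases h : C.SameCube b c
    · obtain ⟨B, rfl⟩ := h
      rw [C.flip_flip, hρb, hρb, C.flip_flip]
    · rw [hρ c h, hρ]
      rintro ⟨B, hB⟩
      exact h ⟨symmDiff A B, by rw [← C.flip_flip, ← hB, flip_flip_self]⟩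
  · intro τ c
    by_cases h : C.SameCube b c
    · obtain ⟨A, rfl⟩ := h
      rw [hρb]
      by_cases hτ : C.labels b ⊆ τ
      · right
        rw [C.face_eq_self _ _ (by rwa [C.labels_flip]),
          C.face_eq_self _ _ (by rwa [C.labels_flip, hl]), hρb, hρa]
      · have hss : C.labels a ∩ τ ⊂ C.labels a := by
          refine Finset.ssubset_iff_subset_ne.2 ⟨Finset.inter_subset_left, fun h => hτ ?_⟩
          rw [← hl, ← h]
          exact Finset.inter_subset_right
        rcases hbd A _ hss with h0 | h0
        · left
          rw [IsVertex, C.labels_face, C.labels_flip, ← hl, h0]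
        · right
          have h1 := face_inter_labels τ (C.flip A a)
          have h2 := face_inter_labels τ (C.flip A b)
          rw [C.labels_flip] at h1 h2
          rw [← hl] at h2
          rw [← h1, ← h2, h0]
    · right
      rw [hρ c h]
  · intro c c' h
    have ha : ρ a = a := by simpa [flip_empty] using hρa ∅
    have hb : ρ b = a := by simpa [flip_empty] using hρb ∅
    rcases hR c c' h with ⟨rfl | rfl, rfl | rfl⟩ <;> simp [hl, ha, hb]

theorem Foldable.exists_isFold {d e : C.Cell} (h : C.Foldable d e) :
    ∃ (D : CubeComplex Γ) (f : Hom C D), f.IsFold ∧ Function.Surjective f.toFun ∧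
      f.toFun d = f.toFun e := by
  obtain ⟨⟨s, hd, he⟩, -, hne⟩ := id h
  obtain ⟨D, f, hf⟩ := exists_isQuotientMap_of_pair (R := fun c c' => c = d ∧ c' = e)
    (hd.trans he.symm) hne
    (fun A τ hτ => .inl (by
      rw [show C.labels d = {s} from hd, Finset.ssubset_singleton_iff] at hτ; exact hτ))
    (by rw [show C.labels d = {s} from hd]; exact Finset.singleton_ne_empty s)
    (fun c c' h => ⟨.inl h.1, .inr h.2⟩)
  exact ⟨D, f, ⟨d, e, h, hf⟩, hf.1, (hf.2 _ _).2 (.of _ _ ⟨rfl, rfl⟩)⟩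

theorem Identifiable.symm {c c' : C.Cell} (h : C.Identifiable c c') : C.Identifiable c' c := by
  obtain ⟨h1, ⟨h2, h3⟩, h4⟩ := h
  exact ⟨h2 ▸ h1, ⟨h2.symm, fun A τ hτ => (h3 A τ (h2 ▸ hτ)).symm⟩, fun h => h4 h.symm⟩

theorem Identifiable.exists_isCubeIdentification {a b : C.Cell} (h : C.Identifiable a b) :
    ∃ (D : CubeComplex Γ) (f : Hom C D), f.IsCubeIdentification ∧ Function.Surjective f.toFun ∧
      f.toFun a = f.toFun b := by
  obtain ⟨h1, ⟨h2, h3⟩, h4⟩ := id h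
  have hab : a ≠ b := by
    rintro rfl
    exact h4 ⟨∅, (flip_empty a).symm⟩
  obtain ⟨D, f, hf⟩ := exists_isQuotientMap_of_pair
    (R := fun c c' => c ∈ ({a, b} : Set C.Cell) ∧ c' ∈ ({a, b} : Set C.Cell)) h2 h4
    (fun A τ hτ => .inr (h3 A τ hτ)) (by rintro h0; simp [h0] at h1) (fun c c' h => h)
  refine ⟨D, f, ⟨{a, b}, Set.nontrivial_pair hab, ?_, hf⟩, hf.1, (hf.2 _ _).2 (.of _ _ ?_)⟩
  · rw [Set.pairwise_pair]
    exact fun _ => ⟨h, h.symm⟩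
  · exact ⟨.inl rfl, .inr rfl⟩

theorem IsStar.exists_isCubeAttachment {v : C.Cell} {σ : Finset V} {d : V → C.Cell}
    (h : C.IsStar v σ d) (hσ : Γ.IsClique (σ : Set V)) :
    ∃ (D : CubeComplex Γ) (f : Hom C D), f.IsCubeAttachment ∧
      (∃ g : (C.sum (stdCube σ hσ)).Cell → D.Cell, Function.Surjective g) ∧
      ∃ c, D.labels c = σ ∧ ∀ s ∈ σ, D.face {s} c = f.toFun (d s) := by
  classical
  -- The representative of an edge of the cube at the base corner is the edge of `C` to which it is
  -- glued.
  let E : (stdCube σ hσ).Cell → V → Prop := fun x s => s ∈ σ ∧ x.1.1 = {s} ∧ x.1.2 ⊆ {s}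
  let ρ : (C.sum (stdCube σ hσ)).Cell → (C.sum (stdCube σ hσ)).Cell :=
    Sum.elim Sum.inl fun x => if h : ∃ s, E x s then Sum.inl (C.flip x.1.2 (d h.choose))
      else Sum.inr x
  have hρE : ∀ x s, E x s → ρ (Sum.inr x) = Sum.inl (C.flip x.1.2 (d s)) := by
    intro x s hx
    have hex : ∃ s, E x s := ⟨s, hx⟩
    have hs : hex.choose = s :=
      Finset.singleton_injective (hex.choose_spec.2.1.symm.trans hx.2.1)
    exact (dif_pos hex).trans (congrArg (fun t => Sum.inl (C.flip x.1.2 (d t))) hs)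
  have hρN : ∀ x, (¬ ∃ s, E x s) → ρ (Sum.inr x) = Sum.inr x := fun x hx => dif_neg hx
  have hEflip : ∀ A x s, E x s → E ((stdCube σ hσ).flip A x) s := by
    rintro A x s ⟨hs, h1, h2⟩
    refine ⟨hs, h1, ?_⟩
    change symmDiff x.1.2 (A ∩ x.1.1) ⊆ {s}
    intro y hy
    rcases Finset.mem_symmDiff.1 hy with hy | hy
    · exact h2 hy.1
    · exact h1 ▸ (Finset.mem_inter.1 hy.1).2
  obtain ⟨D, q, hq⟩ := exists_isQuotientMap_of_retraction (R := C.AttachRel v σ hσ d) ρ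
    (by
      rintro (c | x)
      · rfl
      · by_cases hx : ∃ s, E x s
        · obtain ⟨s, hx⟩ := hx
          rw [hρE x s hx]
          exact (C.labels_flip _ _).trans ((h.2 s hx.1).1.trans hx.2.1.symm)
        · rw [hρN x hx])
    (by
      rintro A (c | x)
      · rfl
      · by_cases hx : ∃ s, E x s
        · obtain ⟨s, hx⟩ := hx
          have h1 := hρE _ s (hEflip A x s hx)
          refine h1.trans ?_
          rw [hρE x s hx]
          change Sum.inl _ = Sum.inl (C.flip A (C.flip x.1.2 (d s)))
          rw [C.flip_flip, Sum.inl.injEq, flip_eq_flip_iff, (h.2 s hx.1).1,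
            Finset.disjoint_singleton_right]
          change s ∉ symmDiff (symmDiff A x.1.2) (symmDiff x.1.2 (A ∩ x.1.1))
          rw [hx.2.1]
          simp only [Finset.mem_symmDiff, Finset.mem_inter, Finset.mem_singleton]
          tauto
        · have hx' : ¬ ∃ s, E ((stdCube σ hσ).flip A x) s := by
            rintro ⟨s, hs⟩
            have := hEflip A _ s hs
            rw [flip_flip_self] at this
            exact hx ⟨s, this⟩
          rw [hρN x hx]
          exact hρN _ hx')
    (by
      rintro τ (c | x)
      · exact .inr rfl
      · by_cases hx : ∃ s, E x s
        · obtain ⟨s, hx⟩ := hx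
          by_cases hs : s ∈ τ
          · right
            rw [(C.sum _).face_eq_self τ (Sum.inr x) (by
              change x.1.1 ⊆ τ
              rw [hx.2.1]; exact Finset.singleton_subset_iff.2 hs)]
            rw [hρE x s hx, (C.sum _).face_eq_self τ (Sum.inl _) (by
              change C.labels _ ⊆ τ
              rw [C.labels_flip, (h.2 s hx.1).1]; exact Finset.singleton_subset_iff.2 hs)]
            rfl
          · left
            change x.1.1 ∩ τ = ∅
            rw [hx.2.1, Finset.singleton_inter_of_notMem hs]
        · right
          rw [hρN x hx])
    (by
      rintro _ _ (_ | ⟨s, hs⟩)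
      · exact ⟨h.1, .inl h.1⟩
      · refine ⟨(h.2 s hs).1, .inr ?_⟩
        rw [hρE _ s ⟨hs, rfl, Finset.empty_subset _⟩]
        exact congrArg Sum.inl (flip_empty (d s)).symm)
  refine ⟨D, ⟨fun c => q.toFun (Sum.inl c), fun c => q.labels_toFun _,
    fun A c => q.toFun_flip A (Sum.inl c), fun τ c => q.toFun_face τ (Sum.inl c)⟩,
    ⟨v, σ, hσ, d, q, h, hq, fun _ => rfl⟩, ⟨q.toFun, hq.1⟩, ?_⟩
  let c : (stdCube σ hσ).Cell := ⟨(σ, ∅), Finset.Subset.refl σ, Finset.empty_subset σ⟩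
  refine ⟨q.toFun (Sum.inr c), q.labels_toFun _, fun s hs => ?_⟩
  refine (q.toFun_face {s} (Sum.inr c)).symm.trans
    (Eq.trans (congrArg q.toFun ?_) ((hq.2 _ _).2 (.of _ _ (.edge s hs))).symm)
  exact congrArg Sum.inr (Subtype.ext (Prod.ext (Finset.inter_singleton_of_mem hs) rfl))

end Quotient

/-! ### Direct limits of sequences of operations -/

section Limit

variable {X : CubeComplex Γ} (Q : OperationSequence X)

/-- The composite map `Ω_n → Ω_m` of the sequence, for `n ≤ m`. -/
def OperationSequence.lift {n m : ℕ} (h : n ≤ m) : (Q.obj n).Cell → (Q.obj m).Cell :=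
  Nat.leRecOn (C := fun k => (Q.obj k).Cell) h fun {k} => (Q.map k).toFun

theorem OperationSequence.lift_self {n : ℕ} (c : (Q.obj n).Cell) : Q.lift le_rfl c = c :=
  Nat.leRecOn_self (C := fun k => (Q.obj k).Cell) c

theorem OperationSequence.lift_succ {n m : ℕ} (h : n ≤ m) (c : (Q.obj n).Cell) :
    Q.lift (h.trans m.le_succ) c = (Q.map m).toFun (Q.lift h c) :=
  Nat.leRecOn_succ (C := fun k => (Q.obj k).Cell) h c

theorem OperationSequence.lift_lift {n m k : ℕ} (h : n ≤ m) (h' : m ≤ k) (c : (Q.obj n).Cell) :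
    Q.lift h' (Q.lift h c) = Q.lift (h.trans h') c :=
  (Nat.leRecOn_trans (C := fun k => (Q.obj k).Cell) h h' c).symm

theorem OperationSequence.trans_eq_lift (n k : ℕ) (c : (Q.obj n).Cell) :
    Q.trans n k c = Q.lift (Nat.le_add_right n k) c := by
  induction k with
  | zero => exact (Q.lift_self c).symm
  | succ k ih =>
    refine Eq.trans ?_ (Q.lift_succ (Nat.le_add_right n k) c).symm
    rw [← ih]; rfl

/-- `OperationSequence.lift` as a map of complexes. -/
def OperationSequence.liftHom {n m : ℕ} (h : n ≤ m) : Hom (Q.obj n) (Q.obj m) where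
  toFun := Q.lift h
  labels_toFun c := by
    induction m, h using Nat.le_induction with
    | base => rw [Q.lift_self]
    | succ m h ih => rw [Q.lift_succ h, (Q.map m).labels_toFun, ih]
  toFun_flip A c := by
    induction m, h using Nat.le_induction with
    | base => rw [Q.lift_self, Q.lift_self]
    | succ m h ih => rw [Q.lift_succ h, Q.lift_succ h, ih, (Q.map m).toFun_flip]
  toFun_face τ c := by
    induction m, h using Nat.le_induction with
    | base => rw [Q.lift_self, Q.lift_self]
    | succ m h ih => rw [Q.lift_succ h, Q.lift_succ h, ih, (Q.map m).toFun_face]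

/-- Two cells of complexes of the sequence are identified in the limit if they have the same image
at some stage. -/
def OperationSequence.limitSetoid : Setoid (Σ n, (Q.obj n).Cell) where
  r x y := ∃ (m : ℕ) (hx : x.1 ≤ m) (hy : y.1 ≤ m), Q.lift hx x.2 = Q.lift hy y.2
  iseqv := ⟨fun x => ⟨x.1, le_rfl, le_rfl, rfl⟩, fun ⟨m, hx, hy, e⟩ => ⟨m, hy, hx, e.symm⟩,
    fun {x y z} ⟨m, hx, hy, e⟩ ⟨k, hy', hz, e'⟩ =>
      ⟨max m k, hx.trans (le_max_left m k), hz.trans (le_max_right m k), by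
        rw [← Q.lift_lift hx (le_max_left m k), e, Q.lift_lift,
          ← Q.lift_lift hy' (le_max_right m k), e', Q.lift_lift]⟩⟩

/-- The direct limit of a sequence of operations. -/
def OperationSequence.limit : CubeComplex Γ where
  Cell := Quotient Q.limitSetoid
  labels := Quotient.lift (fun x => (Q.obj x.1).labels x.2) fun x y ⟨m, hx, hy, e⟩ => by
    have h1 := (Q.liftHom hx).labels_toFun x.2
    have h2 := (Q.liftHom hy).labels_toFun y.2
    exact h1.symm.trans ((congrArg _ e).trans h2)
  flip A := Quotient.map (fun x => ⟨x.1, (Q.obj x.1).flip A x.2⟩) fun x y ⟨m, hx, hy, e⟩ =>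
    ⟨m, hx, hy, ((Q.liftHom hx).toFun_flip A x.2).trans
      ((congrArg _ e).trans ((Q.liftHom hy).toFun_flip A y.2).symm)⟩
  face τ := Quotient.map (fun x => ⟨x.1, (Q.obj x.1).face τ x.2⟩) fun x y ⟨m, hx, hy, e⟩ =>
    ⟨m, hx, hy, ((Q.liftHom hx).toFun_face τ x.2).trans
      ((congrArg _ e).trans ((Q.liftHom hy).toFun_face τ y.2).symm)⟩
  isClique_labels := Quotient.ind fun x => (Q.obj x.1).isClique_labels x.2
  labels_flip A := Quotient.ind fun x => (Q.obj x.1).labels_flip A x.2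
  flip_flip A B := Quotient.ind fun x =>
    congrArg (fun c => Quotient.mk Q.limitSetoid ⟨x.1, c⟩) ((Q.obj x.1).flip_flip A B x.2)
  flip_eq_self_iff A := Quotient.ind fun x => by
    constructor
    · intro h
      obtain ⟨m, hx, hy, e⟩ := Quotient.exact h
      have h1 : (Q.obj m).flip A (Q.lift hx x.2) = Q.lift hx x.2 :=
        ((Q.liftHom hx).toFun_flip A x.2).symm.trans e
      have h2 := ((Q.obj m).flip_eq_self_iff A _).1 h1
      have h3 : (Q.obj m).labels (Q.lift hx x.2) = (Q.obj x.1).labels x.2 :=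
        (Q.liftHom hx).labels_toFun x.2
      rw [h3] at h2
      exact h2
    · intro h
      exact congrArg (fun c => Quotient.mk Q.limitSetoid ⟨x.1, c⟩)
        (((Q.obj x.1).flip_eq_self_iff A x.2).2 h)
  labels_face τ := Quotient.ind fun x => (Q.obj x.1).labels_face τ x.2
  face_eq_self τ := Quotient.ind fun x h =>
    congrArg (fun c => Quotient.mk Q.limitSetoid ⟨x.1, c⟩) ((Q.obj x.1).face_eq_self τ x.2 h)
  face_face τ τ' := Quotient.ind fun x =>
    congrArg (fun c => Quotient.mk Q.limitSetoid ⟨x.1, c⟩) ((Q.obj x.1).face_face τ τ' x.2)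
  face_flip A τ := Quotient.ind fun x h =>
    congrArg (fun c => Quotient.mk Q.limitSetoid ⟨x.1, c⟩) ((Q.obj x.1).face_flip A τ x.2 h)

/-- The canonical map to the direct limit. -/
def OperationSequence.toLimit (n : ℕ) : Hom (Q.obj n) Q.limit :=
  ⟨fun c => Quotient.mk Q.limitSetoid ⟨n, c⟩, fun _ => rfl, fun _ _ => rfl, fun _ _ => rfl⟩

theorem OperationSequence.isDirectLimit_limit : Q.IsDirectLimit Q.limit Q.toLimit where
  compat n c := Quotient.sound ⟨n + 1, le_rfl, n.le_succ, by
    change Q.lift le_rfl ((Q.map n).toFun c) = Q.lift n.le_succ c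
    rw [Q.lift_self, Q.lift_succ le_rfl, Q.lift_self]⟩
  surj := Quotient.ind fun x => ⟨x.1, x.2, rfl⟩
  eq_iff n c c' := by
    constructor
    · intro h
      obtain ⟨m, hx, hy, e⟩ := Quotient.exact h
      obtain ⟨k, rfl⟩ := Nat.exists_eq_add_of_le hx
      exact ⟨k, by rw [Q.trans_eq_lift, Q.trans_eq_lift]; exact e⟩
    · rintro ⟨k, e⟩
      rw [Q.trans_eq_lift, Q.trans_eq_lift] at e
      exact Quotient.sound ⟨n + k, Nat.le_add_right n k, Nat.le_add_right n k, e⟩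

variable {Q}

theorem OperationSequence.IsDirectLimit.exists_stage {Ω : CubeComplex Γ}
    {φ : ∀ n, Hom (Q.obj n) Ω} (h : Q.IsDirectLimit Ω φ) {ι : Type*} [Finite ι] (x : ι → Ω.Cell) :
    ∃ (n : ℕ) (y : ι → (Q.obj n).Cell), ∀ i, (φ n).toFun (y i) = x i := by
  have := Fintype.ofFinite ι
  choose n y hy using fun i => h.surj (x i)
  have hle : ∀ i, n i ≤ Finset.univ.sup n := fun i => Finset.le_sup (Finset.mem_univ i)
  refine ⟨Finset.univ.sup n, fun i => Q.lift (hle i) (y i), fun i => ?_⟩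
  have aux : ∀ m (hm : n i ≤ m), (φ m).toFun (Q.lift hm (y i)) = (φ (n i)).toFun (y i) := by
    intro m hm
    obtain ⟨k, rfl⟩ := Nat.exists_eq_add_of_le hm
    rw [← Q.trans_eq_lift, h.compat_trans]
  rw [aux, hy]

theorem OperationSequence.IsDirectLimit.exists_forall_eq {Ω : CubeComplex Γ}
    {φ : ∀ n, Hom (Q.obj n) Ω} (h : Q.IsDirectLimit Ω φ) {ι : Type*} [Finite ι] {n : ℕ}
    {x y : ι → (Q.obj n).Cell} (hxy : ∀ i, (φ n).toFun (x i) = (φ n).toFun (y i)) :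
    ∃ k, ∀ i, Q.trans n k (x i) = Q.trans n k (y i) := by
  have := Fintype.ofFinite ι
  choose k hk using fun i => (h.eq_iff n _ _).1 (hxy i)
  have hmono : ∀ j k, j ≤ k → ∀ c c', Q.trans n j c = Q.trans n j c' →
      Q.trans n k c = Q.trans n k c' := by
    intro j k hjk c c' e
    induction k, hjk using Nat.le_induction with
    | base => exact e
    | succ k _ ih => exact congrArg (Q.map (n + k)).toFun ih
  exact ⟨Finset.univ.sup k, fun i =>
    hmono _ _ (Finset.le_sup (Finset.mem_univ i)) _ _ (hk i)⟩

end Limit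

/-! ### Existence of standard completions -/

section Existence

/-- A task in a complex: a pair of cells that may have to be identified by a fold or by a cube
identification, or a tuple of edges to which a cube may have to be attached. -/
abbrev Task (C : CubeComplex Γ) : Type u :=
  (C.Cell × C.Cell) ⊕ (C.Cell × Finset V × (V → C.Cell))

/-- The image of a task under a map. -/
def Task.map {C D : CubeComplex Γ} (f : C.Cell → D.Cell) : Task C → Task D :=
  Sum.map (Prod.map f f) fun t => (f t.1, t.2.1, f ∘ t.2.2)

/-- The map `f` accomplishes the task. -/
def Hom.Accomplishes {C D : CubeComplex Γ} (f : Hom C D) : Task C → Prop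
  | .inl (a, b) => C.Foldable a b ∨ C.Identifiable a b → f.toFun a = f.toFun b
  | .inr (v, σ, d) => Γ.IsClique (σ : Set V) → C.IsStar v σ d →
    ∃ c, D.labels c = σ ∧ ∀ s ∈ σ, D.face {s} c = f.toFun (d s)

theorem exists_accomplishes {C : CubeComplex Γ} [Countable C.Cell] [Finite V] (t : Task C) :
    ∃ (D : CubeComplex Γ) (f : Hom C D), (f.IsFold ∨ f.IsCubeIdentification ∨
      f.IsCubeAttachment ∨ f.IsIso) ∧ Countable D.Cell ∧ f.Accomplishes t := by
  have hid : (⟨id, fun _ => rfl, fun _ _ => rfl, fun _ _ => rfl⟩ : Hom C C).IsIso :=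
    Function.bijective_id
  rcases t with ⟨a, b⟩ | ⟨v, σ, d⟩
  · by_cases h : C.Foldable a b
    · obtain ⟨D, f, hf, hs, e⟩ := h.exists_isFold
      exact ⟨D, f, .inl hf, hs.countable, fun _ => e⟩
    · by_cases h' : C.Identifiable a b
      · obtain ⟨D, f, hf, hs, e⟩ := h'.exists_isCubeIdentification
        exact ⟨D, f, .inr (.inl hf), hs.countable, fun _ => e⟩
      · exact ⟨C, _, .inr (.inr (.inr hid)), inferInstance, fun h'' => (h''.elim h h').elim⟩
  · by_cases hσ : Γ.IsClique (σ : Set V)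
    · by_cases h : C.IsStar v σ d
      · obtain ⟨D, f, hf, ⟨g, hg⟩, hc⟩ := h.exists_isCubeAttachment hσ
        have : Countable (C.sum (stdCube σ hσ)).Cell := by
          change Countable (C.Cell ⊕ {p : Finset V × Finset V // p.1 ⊆ σ ∧ p.2 ⊆ σ})
          infer_instance
        exact ⟨D, f, .inr (.inr (.inl hf)), hg.countable, fun _ _ => hc⟩
      · exact ⟨C, _, .inr (.inr (.inr hid)), inferInstance, fun _ h' => (h h').elim⟩
    · exact ⟨C, _, .inr (.inr (.inr hid)), inferInstance, fun h' => (hσ h').elim⟩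

variable (Γ) in
/-- A stage in the construction of a completion: a complex, with enumerations of the tasks that were
present at the earlier stages. -/
structure TaskState where
  obj : CubeComplex Γ
  countable : Countable obj.Cell
  nonempty : Nonempty obj.Cell
  tasks : ℕ → ℕ → Task obj

theorem exists_surjective_task (C : CubeComplex Γ) (h : Countable C.Cell) (h' : Nonempty C.Cell)
    [Finite V] : ∃ e : ℕ → Task C, Function.Surjective e := by
  have : Nonempty (Task C) := h'.map fun c => .inl (c, c)
  exact exists_surjective_nat _

theorem IsStar.map {C D : CubeComplex Γ} (f : Hom C D) {v : C.Cell} {σ : Finset V}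
    {d : V → C.Cell} (h : C.IsStar v σ d) : D.IsStar (f.toFun v) σ (f.toFun ∘ d) :=
  ⟨(f.labels_toFun v).trans h.1, fun s hs => ⟨(f.labels_toFun _).trans (h.2 s hs).1,
    (f.source_toFun _).trans (congrArg _ (h.2 s hs).2)⟩⟩

variable [Finite V]

namespace TaskState

/-- The task carried out at the stage `n`. The double unpairing makes each task return at
arbitrarily late stages. -/
def task (Y : TaskState Γ) (n : ℕ) : Task Y.obj :=
  Y.tasks n.unpair.1.unpair.1 n.unpair.1.unpair.2

/-- The complex in which the task of the stage `n` is accomplished. -/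
noncomputable def nextObj (Y : TaskState Γ) (n : ℕ) : CubeComplex Γ :=
  Classical.choose (@exists_accomplishes _ _ _ Y.obj Y.countable _ (Y.task n))

/-- The operation that accomplishes the task of the stage `n`. -/
noncomputable def nextMap (Y : TaskState Γ) (n : ℕ) : Hom Y.obj (Y.nextObj n) :=
  Classical.choose (Classical.choose_spec
    (@exists_accomplishes _ _ _ Y.obj Y.countable _ (Y.task n)))

theorem nextMap_spec (Y : TaskState Γ) (n : ℕ) :
    ((Y.nextMap n).IsFold ∨ (Y.nextMap n).IsCubeIdentification ∨ (Y.nextMap n).IsCubeAttachment ∨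
      (Y.nextMap n).IsIso) ∧ Countable (Y.nextObj n).Cell ∧
      (Y.nextMap n).Accomplishes (Y.task n) :=
  Classical.choose_spec (Classical.choose_spec
    (@exists_accomplishes _ _ _ Y.obj Y.countable _ (Y.task n)))

theorem nonempty_nextObj (Y : TaskState Γ) (n : ℕ) : Nonempty (Y.nextObj n).Cell :=
  Y.nonempty.map (Y.nextMap n).toFun

/-- The next stage: the old tasks are transported, and the tasks of the new complex are
enumerated. -/
noncomputable def next (Y : TaskState Γ) (n : ℕ) : TaskState Γ where
  obj := Y.nextObj n
  countable := (Y.nextMap_spec n).2.1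
  nonempty := Y.nonempty_nextObj n
  tasks i j := if i ≤ n then (Y.tasks i j).map (Y.nextMap n).toFun
    else Classical.choose (exists_surjective_task _ (Y.nextMap_spec n).2.1
      (Y.nonempty_nextObj n)) j

end TaskState

/-- Every nonempty countable complex has a sequence of operations in which each task that is present
at some stage is accomplished at a later one. -/
theorem exists_operationSequence (X : CubeComplex Γ) (hX : Countable X.Cell)
    (hX' : Nonempty X.Cell) : ∃ Q : OperationSequence X, ∀ n (t : Task (Q.obj n)),
      ∃ k, (Q.map (n + k)).Accomplishes (t.map (Q.trans n k)) := by
  obtain ⟨e, he⟩ := exists_surjective_task X hX hX'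
  let Y : ℕ → TaskState Γ := fun n => Nat.rec ⟨X, hX, hX', fun _ => e⟩ (fun n Y => Y.next n) n
  have hsurj : ∀ n, Function.Surjective ((Y n).tasks n) := by
    rintro (_ | n)
    · exact he
    · have h1 : (Y (n + 1)).tasks (n + 1) = Classical.choose (exists_surjective_task _
          ((Y n).nextMap_spec n).2.1 ((Y n).nonempty_nextObj n)) :=
        funext fun j => if_neg (by omega)
      rw [h1]
      exact Classical.choose_spec (exists_surjective_task _
          ((Y n).nextMap_spec n).2.1 ((Y n).nonempty_nextObj n))
  let Q : OperationSequence X :=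
    { obj := fun n => (Y n).obj
      map := fun n => (Y n).nextMap n
      init := ⟨id, fun _ => rfl, fun _ _ => rfl, fun _ _ => rfl⟩
      isIso_init := Function.bijective_id
      isOperation := fun n => ((Y n).nextMap_spec n).1 }
  refine ⟨Q, fun n t => ?_⟩
  obtain ⟨j, rfl⟩ := hsurj n t
  have htasks : ∀ k, (Y (n + k)).tasks n j = ((Y n).tasks n j).map (Q.trans n k) := by
    intro k
    induction k with
    | zero =>
      change (Y n).tasks n j = ((Y n).tasks n j).map id
      rcases (Y n).tasks n j with t | t <;> rfl
    | succ k ih =>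
      have h1 : (Y (n + k + 1)).tasks n j =
          ((Y (n + k)).tasks n j).map ((Y (n + k)).nextMap (n + k)).toFun :=
        if_pos (Nat.le_add_right n k)
      refine h1.trans ?_
      rw [ih]
      rcases (Y n).tasks n j with t | t <;> rfl
  obtain ⟨k, hk⟩ := Nat.exists_eq_add_of_le (Nat.right_le_pair (Nat.pair n j) n)
  refine ⟨k, ?_⟩
  have h1 := ((Y (n + k)).nextMap_spec (n + k)).2.2
  have h2 : (Y (n + k)).task (n + k) = (Y (n + k)).tasks n j := by
    rw [TaskState.task, ← hk]
    simp
  rw [h2, htasks] at h1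
  exact h1

/-- The direct limit of a sequence in which all tasks are accomplished is folded and cube-full, since
a fold, a cube identification or a missing cube in the limit is a task at a finite stage. -/
theorem exists_isCompletionOfComplex (X : CubeComplex Γ) (hX : Countable X.Cell)
    (hX' : Nonempty X.Cell) : ∃ Ω, IsCompletionOfComplex X Ω := by
  obtain ⟨Q, hQ⟩ := exists_operationSequence X hX hX'
  have hlim := Q.isDirectLimit_limit
  have hhom : ∀ n k, ∃ f : Hom (Q.obj n) (Q.obj (n + k)), f.toFun = Q.trans n k := fun n k =>
    ⟨Q.liftHom (Nat.le_add_right n k), funext fun c => (Q.trans_eq_lift n k c).symm⟩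
  have hex : ∀ {n} {a b : (Q.obj n).Cell}, (∀ k, (Q.obj (n + k)).Foldable (Q.trans n k a)
      (Q.trans n k b) ∨ (Q.obj (n + k)).Identifiable (Q.trans n k a) (Q.trans n k b)) →
      (Q.toLimit n).toFun a = (Q.toLimit n).toFun b := by
    intro n a b h
    obtain ⟨k, hk⟩ := hQ n (.inl (a, b))
    exact (hlim.eq_iff n a b).2 ⟨k + 1, hk (h k)⟩
  have hsame : ∀ {n} {a b : (Q.obj n).Cell} (k : ℕ),
      ¬ Q.limit.SameCube ((Q.toLimit n).toFun a) ((Q.toLimit n).toFun b) →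
      ¬ (Q.obj (n + k)).SameCube (Q.trans n k a) (Q.trans n k b) := by
    rintro n a b k h ⟨A, hA⟩
    refine h ⟨A, ?_⟩
    rw [← hlim.compat_trans n k, ← hlim.compat_trans n k, hA, Hom.toFun_flip]
  have hrefl : ∀ c : Q.limit.Cell, Q.limit.SameCube c c := fun c => ⟨∅, (flip_empty c).symm⟩
  refine ⟨Q.limit, ⟨Q, Q.toLimit, hlim⟩, ⟨?_, ?_⟩, ?_⟩
  · rintro d e ⟨⟨s, hd, he⟩, hsrc, hne⟩
    obtain ⟨n, y, hy⟩ := hlim.exists_stage fun b : Bool => if b then d else e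
    obtain rfl : (Q.toLimit n).toFun (y true) = d := hy true
    obtain rfl : (Q.toLimit n).toFun (y false) = e := hy false
    obtain ⟨k, hk⟩ := hlim.exists_forall_eq (ι := Unit) (n := n)
      (x := fun _ => (Q.obj n).source (y true)) (y := fun _ => (Q.obj n).source (y false))
      (fun _ => hsrc)
    obtain ⟨f, hf⟩ := hhom n k
    have h1 : (Q.toLimit (n + k)).toFun (Q.trans n k (y true)) =
        (Q.toLimit (n + k)).toFun (Q.trans n k (y false)) := by
      refine hex fun l => .inl ⟨⟨s, ?_, ?_⟩, ?_, hsame l ?_⟩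
      all_goals obtain ⟨g, hg⟩ := hhom (n + k) l
      all_goals simp only [← hf, ← hg]
      · exact (g.labels_toFun _).trans ((f.labels_toFun _).trans hd)
      · exact (g.labels_toFun _).trans ((f.labels_toFun _).trans he)
      · rw [g.source_toFun, g.source_toFun, f.source_toFun, f.source_toFun, hf, hk ()]
      · rw [hf, hlim.compat_trans, hlim.compat_trans]
        exact hne
    rw [hlim.compat_trans, hlim.compat_trans] at h1
    exact hne (h1 ▸ hrefl _)
  · rintro d e ⟨hcard, ⟨hl, hbd⟩, hne⟩
    obtain ⟨n, y, hy⟩ := hlim.exists_stage fun b : Bool => if b then d else e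
    obtain rfl : (Q.toLimit n).toFun (y true) = d := hy true
    obtain rfl : (Q.toLimit n).toFun (y false) = e := hy false
    -- The boundaries agree from some stage on.
    obtain ⟨k, hk⟩ := hlim.exists_forall_eq
      (ι := Finset V × {τ // τ ⊂ (Q.obj n).labels (y true)}) (n := n)
      (x := fun p => (Q.obj n).face p.2 ((Q.obj n).flip p.1 (y true)))
      (y := fun p => (Q.obj n).face p.2 ((Q.obj n).flip p.1 (y false)))
      (fun p => by
        have := hbd p.1 p.2 p.2.2
        rwa [← Hom.toFun_flip, ← Hom.toFun_flip, ← Hom.toFun_face, ← Hom.toFun_face] at this)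
    obtain ⟨f, hf⟩ := hhom n k
    have h1 : (Q.toLimit (n + k)).toFun (Q.trans n k (y true)) =
        (Q.toLimit (n + k)).toFun (Q.trans n k (y false)) := by
      refine hex fun l => .inr ⟨?_, ⟨?_, ?_⟩, hsame l ?_⟩
      all_goals obtain ⟨g, hg⟩ := hhom (n + k) l
      all_goals simp only [← hf, ← hg]
      · rw [g.labels_toFun, f.labels_toFun]; exact hcard
      · rw [g.labels_toFun, f.labels_toFun, g.labels_toFun, f.labels_toFun]; exact hl
      · intro A τ hτ
        rw [g.labels_toFun, f.labels_toFun] at hτ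
        have := hk (A, ⟨τ, hτ⟩)
        simp only [← hf, f.toFun_face, f.toFun_flip] at this
        rw [← g.toFun_flip, ← g.toFun_flip, ← g.toFun_face, ← g.toFun_face, this]
      · rw [hf, hlim.compat_trans, hlim.compat_trans]
        exact hne
    rw [hlim.compat_trans, hlim.compat_trans] at h1
    exact hne (h1 ▸ hrefl _)
  · intro v σ d hσ hstar
    obtain ⟨n, y, hy⟩ := hlim.exists_stage fun o : Option V => o.elim v d
    have hv : (Q.toLimit n).toFun (y none) = v := hy none
    have hd : ∀ s, (Q.toLimit n).toFun (y (some s)) = d s := fun s => hy (some s)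
    obtain ⟨k, hk⟩ := hlim.exists_forall_eq (ι := σ) (n := n)
      (x := fun s => (Q.obj n).source (y (some s))) (y := fun _ => y none)
      (fun s => by rw [← Hom.source_toFun, hd, hv]; exact (hstar.2 s s.2).2)
    obtain ⟨f, hf⟩ := hhom n k
    have hst : (Q.obj (n + k)).IsStar (f.toFun (y none)) σ fun s => f.toFun (y (some s)) := by
      refine ⟨?_, fun s hs => ⟨?_, ?_⟩⟩
      · rw [IsVertex, f.labels_toFun, ← (Q.toLimit n).labels_toFun, hv]
        exact hstar.1
      · rw [IsEdge, f.labels_toFun, ← (Q.toLimit n).labels_toFun, hd]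
        exact (hstar.2 s hs).1
      · rw [f.source_toFun, hf]
        exact hk ⟨s, hs⟩
    obtain ⟨l, hl⟩ := hQ (n + k) (.inr (_, σ, fun s => f.toFun (y (some s))))
    obtain ⟨g, hg⟩ := hhom (n + k) l
    obtain ⟨c, hc, hcd⟩ := hl hσ (by rw [← hg]; exact hst.map g)
    refine ⟨(Q.toLimit _).toFun c, ((Q.toLimit _).labels_toFun c).trans hc, fun s hs => ⟨∅, ?_⟩⟩
    rw [flip_empty, ← Hom.toFun_face, hcd s hs, hlim.compat]
    refine (hlim.compat_trans (n + k) l _).trans ?_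
    rw [hf, hlim.compat_trans, hd]

/-- Every finitely generated subgroup has a standard completion. -/
theorem exists_isStandardCompletion {G : Subgroup (W Γ)} (hG : G.FG) :
    ∃ Ω : CubeComplex Γ, IsStandardCompletion G Ω := by
  obtain ⟨A, hA⟩ := hG
  choose w hw using fun x : W Γ => (system Γ).wordProd_surjective x
  classical
  let T : Finset (List V) := A.image w
  have hT : Subgroup.closure ((system Γ).wordProd '' (T : Set (List V))) = G := by
    rw [← hA, Finset.coe_image, ← Set.image_comp]
    congr 1
    have : (system Γ).wordProd ∘ w = id := funext hw
    rw [this, Set.image_id]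
  have hcount : Countable (RoseCell T) := by
    -- A cell is determined by the data `w`, `j` and the direction.
    let F : RoseCell T → Option ((List V × ℕ) × Option Bool)
      | .base => none
      | .interior w _ j _ _ => some ((w, j), none)
      | .edge w _ j fwd => some ((w, j), some fwd)
    refine Function.Injective.countable (f := F) ?_
    rintro (_ | ⟨w, hw, j, h0, h1⟩ | ⟨w, hw, j, fwd⟩)
      (_ | ⟨w', hw', j', h0', h1'⟩ | ⟨w', hw', j', fwd'⟩) h
    all_goals simp only [F, Option.some.injEq, Prod.mk.injEq, reduceCtorEq, and_false] at h
    · rfl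
    · obtain ⟨⟨rfl, rfl⟩, -⟩ := h
      rfl
    · obtain ⟨⟨rfl, hj⟩, rfl⟩ := h
      obtain rfl := Fin.ext hj
      rfl
  obtain ⟨Ω, hΩ⟩ := exists_isCompletionOfComplex (rose Γ T) hcount ⟨.base⟩
  exact ⟨Ω, T, hT, hΩ⟩

end Existence

end CubeComplex

end RACG

theorem mainTheorem1 {V : Type u} [Finite V] [DecidableEq V] (Γ : SimpleGraph V)
    (G : Subgroup (RACG.W Γ)) :
    List.TFAE [
      RACG.IsQuasiconvexSubgroup Γ G,
      ∃ (Ω : RACG.CubeComplex Γ) (B : Ω.Cell),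
        RACG.CubeComplex.IsCompletion G Ω B ∧ Ω.IsFinite,
      G.FG ∧ ∀ Ω : RACG.CubeComplex Γ,
        RACG.CubeComplex.IsStandardCompletion G Ω → Ω.IsFinite] := by
  tfae_have 1 → 3 := by
    intro h
    refine ⟨?_, fun Ω hΩ => hΩ.isFinite h⟩
    obtain ⟨M, hM⟩ := h
    exact RACG.fg_of_isQuasiconvexWith (RACG.isQuasiconvexWith_iff.1 hM)
  tfae_have 3 → 2 := by
    rintro ⟨hG, hfin⟩
    obtain ⟨Ω, hΩ⟩ := RACG.CubeComplex.exists_isStandardCompletion hG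
    obtain ⟨B, -, -, hB, -⟩ := hΩ.exists_isCompletion
    exact ⟨Ω, B, hB, hfin Ω hΩ⟩
  tfae_have 2 → 1 := by
    rintro ⟨Ω, B, hB, hfin⟩
    exact hB.isQuasiconvexSubgroup hfin
  tfae_finish
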